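/- Let $G$ be a finite graph (loops and multiple edges allowed) with vertex set $V(G)$ and a totally ordered edge set $E(G)$. Let $q\ge 1$ be an integer and $\beta\in\mathbb{C}$, and let each edge $e=\{i,j\}$ carry a value $J_e=J_{i,j}\in\mathbb{C}$ and each vertex $i$ a value $z_i\in\mathbb{C}$. For a state $\sigma:V(G)\to\{1,\dots,q\}$ put $$h(\sigma)=-\sum_{e=\{i,j\}\in E(G)}J_{e}\,\delta(\sigma_i,\sigma_j)-\sum_{i\in V(G)}z_i\,\delta(1,\sigma_i),\qquad Z(G)=\sum_{\sigma}e^{-\beta h(\sigma)},$$ and let $Z_{zero}(H;q)$ be the $q$-state partition function of a graph $H$ with all $z_i=0$. For each induced subgraph $H$ of $G$, $Z_{zero}(H;q)$, as a function of $q=1,2,3,\dots$, is given by a unique polynomial in $q$; let $[q^1]Z_{zero}(H;q)$ be its coefficient of $q^1$. For $w\in\mathbb{C}$ let $X_w=e^{\beta w}+q-1$, and for $S\subseteq V(G)$ let $z(S)=\sum_{i\in S}z_i$. Then: 1. $$Z(G)=\sum_{\pi}\ \prod_{B\in\pi}X_{z(B)}\ \prod_{B\in\pi}[q^1]Z_{zero}(G[B];q),$$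 where $\pi$ runs over the partitions of $V(G)$ each of whose blocks $B$ induces a connected subgraph $G[B]$. 2. $$Z(G)=\sum_{F}\Big(\prod_{S}X_{z(S)}\Big)\Big(\prod_{e\in F}(e^{\beta J_e}-1)\Big)\Big(\prod_{e\in\mathcal{E_A}(G,F)}e^{\beta J_e}\Big),$$ where $F$ runs over the (edge sets of) spanning forests of $G$, that is, acyclic spanning subgraphs, $S$ runs over the vertex sets of the components of $(V(G),F)$, and $\mathcal{E_A}(G,F)$ is the set of edges $e\in E(G)\setminus F$ such that $F\cup\{e\}$ contains a cycle and $e$ is the smallest edge of that cycle. 3. $$Z(G)=\sum_{T}\Big(\prod_{e\in\mathcal{I_I}(G,T)}(e^{\beta J_e}-1)\Big)\Big(\prod_{e\in\mathcal{E_A}(G,T)}e^{\beta J_e}\Big)\,Z\big(T/\mathcal{I_I}(G,T)\big),$$ where $T$ runs over the set $\mathcal{T}(G)$ of (edge sets of) spanning trees of $G$ (spanning forests whose restriction to each component of $G$ is a spanning tree of it), $\mathcal{I_I}(G,T)$ is the set of edges $e\in T$ that are not the smallest element of $\{f\in E(G):(T\setminus\{e\})\cup\{f\}\in\mathcal{T}(G)\}$,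 and in the contraction $T/\mathcal{I_I}(G,T)$ of the graph $(V(G),T)$ the remaining edges keep their values $J_e$ while a merged vertex carries the sum of the values $z_i$ of the vertices merged into it. -/

import Mathlib

namespace Potts

/-! ### Multigraphs: components, connectedness, forests, trees, contraction -/

/-- The set of vertices that can be reached from `v` along edges of `G`; for a vertex `v` of `G`
this is the vertex set of the component of `G` that contains `v`. -/
def component {α β : Type*} (G : Graph α β) (v : α) : Set α :=
  {w | Relation.ReflTransGen G.Adj v w}

/-- The vertex sets of the components of `G`. -/
def components {α β : Type*} (G : Graph α β) : Set (Set α) :=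
  component G '' G.vertexSet

/-- `G` is connected: it has a vertex, and any two vertices are joined by a walk. -/
def IsConnected {α β : Type*} (G : Graph α β) : Prop :=
  G.vertexSet.Nonempty ∧
    ∀ x ∈ G.vertexSet, ∀ y ∈ G.vertexSet, Relation.ReflTransGen G.Adj x y

/-- The set of edges `C` is (the edge set of) a cycle of the multigraph `G`: there are
pairwise distinct vertices `x 0, …, x n` and pairwise distinct edges `e 0, …, e n` such that `e i`
joins `x i` to `x (i + 1)`, indices being taken modulo `n + 1`.  A loop is a cycle (`n = 0`), and so
is a pair of parallel edges (`n = 1`). -/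
def IsCycle {α β : Type*} (G : Graph α β) (C : Set β) : Prop :=
  ∃ (n : ℕ) (x : Fin (n + 1) → α) (e : Fin (n + 1) → β),
    Function.Injective x ∧ Function.Injective e ∧
    (∀ i, G.IsLink (e i) (x i) (x (i + 1))) ∧ C = Set.range e

/-- `𝓕(G)`: the edge sets `F` of the acyclic spanning subgraphs `(V(G), F)` of `G`. -/
def spanningForests {α β : Type*} (G : Graph α β) : Set (Set β) :=
  {F | F ⊆ G.edgeSet ∧ ∀ C, ¬ IsCycle (G.restrict F) C}

/-- `𝓣(G)`: the edge sets `T` of the (maximal) spanning trees of a possibly disconnected `G`, that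
is, of the spanning forests whose restriction to each component of `G` is connected. -/
def spanningTrees {α β : Type*} (G : Graph α β) : Set (Set β) :=
  {T | T ∈ spanningForests G ∧ ∀ S ∈ components G, IsConnected ((G.restrict T).induce S)}

/-- The connected partitions of `V(G)`: each block induces a connected subgraph. -/
def connectedPartitions {α β : Type*} (G : Graph α β) : Set (Finpartition G.vertexSet) :=
  {π | ∀ B ∈ π.parts, IsConnected (G.induce B)}

/-- `G / C` for a set `C` of edges that contains no cycle: the edges of `C` are removed, and the
vertices of each component of the spanning subgraph `(V(G), C)` are merged into a single vertex,
which is represented by the set of the vertices merged into it. -/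
def contract {α β : Type*} (G : Graph α β) (C : Set β) : Graph (Set α) β :=
  (G.deleteEdges C).map (component (G.restrict C))

/-- The sum of the vertex weights `z` over a set of vertices.  In particular these are the vertex
weights of a contraction `G / C`. -/
noncomputable def weightSum {α : Type*} (z : α → ℂ) (S : Set α) : ℂ :=
  ∑ᶠ v ∈ S, z v

/-! ### Activities with respect to the order of the edges -/

/-- `𝓔_A(G, F)`: the externally active edges of `G` with respect to a spanning forest (or tree) `F`,
that is, the edges `e ∉ F` that are the smallest edge of the cycle in `F ∪ {e}`.  An edge that closes
no cycle with `F` is not externally active. -/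
def externallyActive {α β : Type*} [LinearOrder β] (G : Graph α β) (F : Set β) : Set β :=
  {e | e ∈ G.edgeSet ∧ e ∉ F ∧ ∃ C, IsCycle (G.restrict (insert e F)) C ∧ IsLeast C e}

/-- The cut of `G` defined by an edge `e` of a spanning tree `T`. -/
def cut {α β : Type*} (G : Graph α β) (T : Set β) (e : β) : Set β :=
  {f | f ∈ G.edgeSet ∧ insert f (T \ {e}) ∈ spanningTrees G}

/-- `𝓘_I(G, T)`: the internally inactive edges of `G` with respect to a spanning tree `T`, that is,
the edges of `T` that are not the smallest edge of the cut they define. -/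
def internallyInactive {α β : Type*} [LinearOrder β] (G : Graph α β) (T : Set β) : Set β :=
  {e | e ∈ T ∧ ¬ IsLeast (cut G T e) e}

/-! ### The Potts model -/

/-- A state of `G`: a spin at each vertex.  The spins `1, …, q` are represented by the elements
`0, …, q - 1` of `Fin q`. -/
abbrev State {α β : Type*} (G : Graph α β) (q : ℕ) : Type _ :=
  G.vertexSet → Fin q

open Classical in
/-- `δ(σ_i, σ_j)` for an edge `e = {i, j}` of `G`. -/
noncomputable def edgeDelta {α β : Type*} {G : Graph α β} {q : ℕ} (σ : State G q) (e : β) : ℂ :=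
  if ∀ i j : G.vertexSet, G.IsLink e i j → σ i = σ j then 1 else 0

/-- `δ(1, σ_i)`. -/
noncomputable def spinOneDelta {α β : Type*} {G : Graph α β} {q : ℕ} (σ : State G q)
    (i : G.vertexSet) : ℂ :=
  if (σ i : ℕ) + 1 = 1 then 1 else 0

/-- The zero field Hamiltonian `- ∑_{e = {i, j}} J_e δ(σ_i, σ_j)`. -/
noncomputable def zeroHamiltonian {α β : Type*} (G : Graph α β) (J : β → ℂ) {q : ℕ}
    (σ : State G q) : ℂ :=
  - ∑ᶠ e ∈ G.edgeSet, J e * edgeDelta σ e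

/-- The Hamiltonian `- ∑_{e = {i, j}} J_e δ(σ_i, σ_j) - ∑_i z_i δ(1, σ_i)`. -/
noncomputable def hamiltonian {α β : Type*} (G : Graph α β) (J : β → ℂ) (z : α → ℂ) {q : ℕ}
    (σ : State G q) : ℂ :=
  - ∑ᶠ e ∈ G.edgeSet, J e * edgeDelta σ e - ∑ᶠ i : G.vertexSet, z i * spinOneDelta σ i

/-- The `q`-state Potts model partition function `∑_σ exp (- b h(σ))` of a Hamiltonian `h`, at
inverse temperature `b`. -/
noncomputable def partitionFunction {α β : Type*} (G : Graph α β) (q : ℕ) (b : ℂ)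
    (h : State G q → ℂ) : ℂ :=
  ∑ᶠ σ : State G q, Complex.exp (- b * h σ)

/-- `Z(G)`, for the Hamiltonian with a field that acts on spin `1` only. -/
noncomputable def Z {α β : Type*} (G : Graph α β) (q : ℕ) (b : ℂ) (J : β → ℂ) (z : α → ℂ) : ℂ :=
  partitionFunction G q b (hamiltonian G J z)

/-- `Z_zero(G)`, for the zero field Hamiltonian. -/
noncomputable def zeroZ {α β : Type*} (G : Graph α β) (q : ℕ) (b : ℂ) (J : β → ℂ) : ℂ :=
  partitionFunction G q b (zeroHamiltonian G J)

/-- `P` is the zero field partition function of `G` as a polynomial in the number `q` of spins. -/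
def IsZeroPolynomial {α β : Type*} (G : Graph α β) (b : ℂ) (J : β → ℂ) (P : Polynomial ℂ) : Prop :=
  ∀ q : ℕ, 1 ≤ q → P.eval (q : ℂ) = zeroZ G q b J

/-- `Z_zero(G)` as a polynomial in `q`: the polynomial whose values at `q = 1, 2, …` are the `q`-state
zero field partition functions. -/
noncomputable def zeroPolynomial {α β : Type*} (G : Graph α β) (b : ℂ) (J : β → ℂ) :
    Polynomial ℂ :=
  Classical.epsilon (IsZeroPolynomial G b J)

/-- `X_w = exp (b w) + q - 1`. -/
noncomputable def X (q : ℕ) (b w : ℂ) : ℂ :=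
  Complex.exp (b * w) + q - 1

end Potts

namespace Potts

/-! All three formulas are resummations of the random cluster expansion `Z_eq_sum_powerset`. Since a
delta is 0 or 1, `exp (b J δ) = 1 + (exp (b J) - 1) δ`; multiplying out gives a sum over edge sets
`A`, and the deltas of `A` force the spin to be constant on each component of `(V, A)`. Summing over
that common spin gives one factor `X` per component, at the total field of the component.

Connected partitions: group the sets `A` by their partition into components. Such an `A` is an
independent choice of a connected spanning subgraph in each block. With zero field the expansion is
a polynomial in `q` whose exponents count components, so its linear coefficient is the weighted sum
over connected spanning subgraphs (`coeff_zeroPolynomial`, `sum_filter_components_eq_prod`).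

Forests: the edge sets split into the intervals from a forest `F` to `F` together with its
externally active edges (`existsUnique_spanningForest`). Components do not change along an interval,
and summing the weights over it turns each factor `exp (b J) - 1` of an active edge into `exp (b
J)`.

Trees: the forests split into the intervals from the internally inactive edges of a tree `T` to `T`
(`existsUnique_spanningTree`). The externally active edges are constant on an interval
(`externallyActive_eq_of_subset`), and what remains is the random cluster expansion of the
contraction (`componentWeight_contract`).

Both interval partitions are matroid facts, proved through the closure operator `cl` and its
exchange property. -/

/-- `x` and `y` are joined by a walk of `G` with edges in `A`. -/
def Joined {α β : Type*} (G : Graph α β) (A : Set β) (x y : α) : Prop :=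
  Relation.ReflTransGen (G.restrict A).Adj x y

/-- The closure of the edge set `A` in the cycle matroid of `G`: the edges of `G` whose ends are
joined by a walk with edges in `A`. -/
def cl {α β : Type*} (G : Graph α β) (A : Set β) : Set β :=
  {e | e ∈ G.edgeSet ∧ ∀ x y, G.IsLink e x y → Joined G A x y}

/-- Independence in the cycle matroid of `G`. -/
def Indep {α β : Type*} (G : Graph α β) (F : Set β) : Prop :=
  F ⊆ G.edgeSet ∧ ∀ e ∈ F, e ∉ cl G (F \ {e})

/-! ### Closure, exchange and independence in the cycle matroid. -/

section Closure

variable {α β : Type*} {G : Graph α β} {A B S F T : Set β} {e f : β} {x y w a b : α}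

lemma restrict_adj : (G.restrict A).Adj x y ↔ ∃ e ∈ A, G.IsLink e x y := by
  simp only [Graph.Adj, Graph.restrict_isLink]

lemma Joined.refl (x : α) : Joined G A x x := Relation.ReflTransGen.refl

lemma Joined.symm (h : Joined G A x y) : Joined G A y x := by
  induction h with
  | refl => exact Joined.refl _
  | tail _ h ih => exact Relation.ReflTransGen.head h.symm ih

lemma Joined.trans (h : Joined G A x y) (h' : Joined G A y w) : Joined G A x w :=
  Relation.ReflTransGen.trans h h'

lemma Joined.of_isLink (he : e ∈ A) (h : G.IsLink e x y) : Joined G A x y :=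
  Relation.ReflTransGen.single (restrict_adj.2 ⟨e, he, h⟩)

lemma Joined.of_forall (h : Joined G A x y)
    (hAB : ∀ e ∈ A, ∀ x y, G.IsLink e x y → Joined G B x y) : Joined G B x y := by
  induction h with
  | refl => exact Joined.refl _
  | tail _ h ih =>
    obtain ⟨e, he, h⟩ := restrict_adj.1 h
    exact ih.trans (hAB e he _ _ h)

lemma Joined.mono (hAB : A ⊆ B) (h : Joined G A x y) : Joined G B x y :=
  h.of_forall fun _ he _ _ hl ↦ .of_isLink (hAB he) hl

lemma Joined.mem_vertexSet (h : Joined G A x y) (hx : x ∈ G.vertexSet) : y ∈ G.vertexSet := by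
  induction h with
  | refl => exact hx
  | tail _ h _ => exact h.right_mem

lemma Joined.of_subset_cl (hAB : A ⊆ cl G B) (h : Joined G A x y) : Joined G B x y :=
  h.of_forall fun _ he _ _ hl ↦ (hAB he).2 _ _ hl

lemma cl_subset_of_subset_cl (hAB : A ⊆ cl G B) : cl G A ⊆ cl G B :=
  fun _ he ↦ ⟨he.1, fun _ _ hl ↦ (he.2 _ _ hl).of_subset_cl hAB⟩

lemma cl_mono (hAB : A ⊆ B) : cl G A ⊆ cl G B :=
  fun _ he ↦ ⟨he.1, fun _ _ hl ↦ (he.2 _ _ hl).mono hAB⟩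

lemma subset_cl (hA : A ⊆ G.edgeSet) : A ⊆ cl G A :=
  fun _ he ↦ ⟨hA he, fun _ _ hl ↦ .of_isLink he hl⟩

lemma mem_cl_mono (hAB : A ⊆ B) (h : e ∈ cl G A) : e ∈ cl G B := cl_mono hAB h

lemma mem_cl_of_mem (hA : A ⊆ G.edgeSet) (h : e ∈ A) : e ∈ cl G A := subset_cl hA h

lemma mem_cl_of_joined (h : G.IsLink e x y) (hj : Joined G A x y) : e ∈ cl G A := by
  refine ⟨h.edge_mem, fun u v hl ↦ ?_⟩
  obtain ⟨rfl, rfl⟩ | ⟨rfl, rfl⟩ := h.eq_and_eq_or_eq_and_eq hl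
  · exact hj
  · exact hj.symm

/-- Crossing `f` once is enough: after a crossing, a further one either undoes it or starts again
from an end of `f` that `x` already reaches within `S`. -/
lemma Joined.insert_cases (hf : G.IsLink f a b) (h : Joined G (insert f S) x y) :
    Joined G S x y ∨ (Joined G S x a ∧ Joined G S b y) ∨ (Joined G S x b ∧ Joined G S a y) := by
  induction h with
  | refl => exact .inl (Joined.refl _)
  | @tail u v _ h ih =>
    obtain ⟨g, hg, hl⟩ := restrict_adj.1 h
    rcases hg with rfl | hg
    · obtain ⟨rfl, rfl⟩ | ⟨rfl, rfl⟩ := hf.eq_and_eq_or_eq_and_eq hl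
      · rcases ih with ih | ⟨h1, h2⟩ | ⟨h1, h2⟩
        · exact .inr (.inl ⟨ih, .refl _⟩)
        · exact .inr (.inl ⟨h1, .refl _⟩)
        · exact .inl h1
      · rcases ih with ih | ⟨h1, h2⟩ | ⟨h1, h2⟩
        · exact .inr (.inr ⟨ih, .refl _⟩)
        · exact .inl h1
        · exact .inr (.inr ⟨h1, .refl _⟩)
    · have hj : Joined G S u v := .of_isLink hg hl
      rcases ih with ih | ⟨h1, h2⟩ | ⟨h1, h2⟩
      · exact .inl (ih.trans hj)
      · exact .inr (.inl ⟨h1, h2.trans hj⟩)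
      · exact .inr (.inr ⟨h1, h2.trans hj⟩)

/-- A walk joining the ends of `e` must cross `f`; its two remaining pieces, linked by `e`, join the
ends of `f`. -/
lemma cl_exchange (hf : f ∈ G.edgeSet) (he : e ∈ cl G (insert f S)) (he' : e ∉ cl G S) :
    f ∈ cl G (insert e S) := by
  obtain ⟨a, b, hab⟩ := G.exists_isLink_of_mem_edgeSet hf
  obtain ⟨x, y, hxy⟩ := G.exists_isLink_of_mem_edgeSet he.1
  have hS : S ⊆ insert e S := Set.subset_insert _ _
  have hj : Joined G (insert e S) x y := .of_isLink (Set.mem_insert _ _) hxy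
  refine mem_cl_of_joined hab ?_
  rcases (he.2 _ _ hxy).insert_cases hab with h | ⟨h1, h2⟩ | ⟨h1, h2⟩
  · exact absurd (mem_cl_of_joined hxy h) he'
  · exact ((h1.symm.mono hS).trans hj).trans (h2.symm.mono hS)
  · exact ((h2.mono hS).trans hj.symm).trans (h1.mono hS)

lemma Indep.subset (h : Indep G B) (hAB : A ⊆ B) : Indep G A :=
  ⟨hAB.trans h.1, fun e he hc ↦ h.2 e (hAB he) (cl_mono (Set.sdiff_subset_sdiff_left hAB) hc)⟩

lemma Indep.insert_of_notMem_cl (h : Indep G S) (hf : f ∈ G.edgeSet) (hfS : f ∉ cl G S) :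
    Indep G (insert f S) := by
  refine ⟨Set.insert_subset hf h.1, ?_⟩
  have hfS' : f ∉ S := fun h' ↦ hfS (subset_cl h.1 h')
  rintro e (rfl | he) hc
  · exact hfS (cl_mono (by simp) hc)
  · have hne : f ≠ e := fun h' ↦ hfS' (h' ▸ he)
    have h1 : insert f S \ {e} = insert f (S \ {e}) := by
      ext g; simp only [Set.mem_sdiff, Set.mem_insert_iff, Set.mem_singleton_iff]; grind
    rw [h1] at hc
    have := cl_exchange hf hc (h.2 e he)
    rw [Set.insert_sdiff_singleton, Set.insert_eq_of_mem he] at this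
    exact hfS this

/-- An element of the closure of a finite set lies in the closure of a minimal subset, whose elements
can each be exchanged for it. -/
lemma exists_minimal_subset (hS : S.Finite) (he : e ∈ cl G S) :
    ∃ P ⊆ S, e ∈ cl G P ∧ ∀ f ∈ P, e ∉ cl G (P \ {f}) := by
  obtain ⟨P, -, hP⟩ := (hS.finite_subsets.subset
    (t := {P | P ⊆ S ∧ e ∈ cl G P}) fun _ h ↦ h.1).isPWO.exists_le_minimal ⟨le_rfl, he⟩
  refine ⟨P, hP.prop.1, hP.prop.2, fun f hf hc ↦ ?_⟩
  exact (hP.le_of_le ⟨Set.sdiff_subset.trans hP.prop.1, hc⟩ Set.sdiff_subset hf).2 rfl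

/-- If `e` is spanned by the finite independent set `T`, then it is spanned by the edges of its
fundamental circuit. -/
lemma Indep.mem_cl_fundamental (hT : Indep G T) (hfin : T.Finite) (he : e ∈ cl G T) :
    e ∈ cl G {f | f ∈ T ∧ e ∉ cl G (T \ {f})} := by
  obtain ⟨P, hPT, heP, hP⟩ := exists_minimal_subset hfin he
  suffices h : P ⊆ {f | f ∈ T ∧ e ∉ cl G (T \ {f})} from cl_mono h heP
  refine fun f hf ↦ ⟨hPT hf, fun hc ↦ hT.2 f (hPT hf) ?_⟩
  -- If `e` were spanned without `f`, exchanging `f` for `e` in the minimal set `P` would put `f` in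
  -- the closure of `T \ {f}`.
  have h1 : f ∈ cl G (insert e (P \ {f})) := by
    refine cl_exchange (hT.1 (hPT hf)) ?_ (hP f hf)
    rwa [Set.insert_sdiff_singleton, Set.insert_eq_of_mem hf]
  refine cl_subset_of_subset_cl (Set.insert_subset hc ?_) h1
  exact (Set.sdiff_subset_sdiff_left hPT).trans (subset_cl (Set.sdiff_subset.trans hT.1))

end Closure

/-! ### Cycles, forests, trees and activities expressed through closure. -/

section Cycles

variable {α β : Type*} {G : Graph α β} {A B C S F T : Set β} {e f : β} {x y w a b : α}

lemma IsCycle.subset (h : IsCycle (G.restrict A) C) : C ⊆ A := by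
  obtain ⟨n, x, e, -, -, hl, rfl⟩ := h
  rintro _ ⟨i, rfl⟩
  exact (hl i).1

lemma IsCycle.mono (hAB : A ⊆ B) (h : IsCycle (G.restrict A) C) : IsCycle (G.restrict B) C := by
  obtain ⟨n, x, e, hx, he, hl, rfl⟩ := h
  exact ⟨n, x, e, hx, he, fun i ↦ ⟨hAB (hl i).1, (hl i).2⟩, rfl⟩

lemma IsCycle.nonempty (h : IsCycle G C) : C.Nonempty := by
  obtain ⟨n, x, e, -, -, hl, rfl⟩ := h
  exact ⟨e 0, Set.mem_range_self 0⟩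

open Fin.CommRing in
lemma IsCycle.mem_cl (h : IsCycle (G.restrict A) C) (he : e ∈ C) : e ∈ cl G (C \ {e}) := by
  obtain ⟨n, x, c, -, hc, hl, rfl⟩ := h
  obtain ⟨i, rfl⟩ := he
  -- Go round the cycle from the far end of `c i`. Indices are modulo `n + 1`, so `n` steps lead to
  -- `x i`, and `c i` itself would only be the next one.
  have key : ∀ k : ℕ, k ≤ n → Joined G (Set.range c \ {c i}) (x (i + 1)) (x (i + 1 + k)) := by
    intro k
    induction k with
    | zero => intro _; simpa using Joined.refl _
    | succ k ih =>
      intro hk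
      refine (ih (by omega)).trans (Joined.of_isLink (e := c (i + 1 + k)) ⟨⟨_, rfl⟩, ?_⟩ ?_)
      · intro h
        have h1 : i + 1 + (k : Fin (n + 1)) = i := hc h
        have h2 : ((k + 1 : ℕ) : Fin (n + 1)) = 0 := by
          push_cast
          rw [add_assoc] at h1
          rw [add_comm (k : Fin (n + 1))]
          exact add_eq_left.1 h1
        have h3 := congrArg Fin.val h2
        rw [Fin.val_natCast, Nat.mod_eq_of_lt (by omega)] at h3
        simp at h3
      · have := (hl (i + 1 + k)).2
        rwa [Nat.cast_succ, ← add_assoc]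
  have h := key n le_rfl
  have h0 : i + 1 + (n : Fin (n + 1)) = i := by
    have : ((n + 1 : ℕ) : Fin (n + 1)) = 0 := by simp
    rw [add_assoc, add_comm 1, ← Nat.cast_succ, this, add_zero]
  rw [h0] at h
  exact mem_cl_of_joined (hl i).2 h.symm

/-- A walk can be shortened to a path. -/
lemma Joined.exists_path (h : Joined G S x y) :
    ∃ (n : ℕ) (p : ℕ → α), Set.InjOn p {i | i ≤ n} ∧ p 0 = x ∧ p n = y ∧
      ∀ i < n, ∃ e ∈ S, G.IsLink e (p i) (p (i + 1)) := by
  classical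
  -- Loops and multiplicities do not affect reachability, so the path can be taken in the underlying
  -- simple graph.
  have hr : (SimpleGraph.fromRel (G.restrict S).Adj).Reachable x y := by
    induction h with
    | refl => rfl
    | @tail u v _ h ih =>
      refine ih.trans ?_
      by_cases huv : u = v
      · rw [huv]
      · exact (show (SimpleGraph.fromRel (G.restrict S).Adj).Adj u v from
          ⟨huv, .inl h⟩).reachable
  obtain ⟨p, hp⟩ := hr.exists_isPath
  refine ⟨p.length, p.getVert, hp.getVert_injOn, p.getVert_zero, p.getVert_length, fun i hi ↦ ?_⟩
  have := p.adj_getVert_succ hi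
  rw [SimpleGraph.fromRel_adj] at this
  exact restrict_adj.1 (this.2.elim id Graph.Adj.symm)

lemma exists_isCycle_of_mem_cl (he : e ∈ cl G S) (heS : e ∉ S) :
    ∃ C, IsCycle (G.restrict (insert e S)) C ∧ e ∈ C := by
  obtain ⟨x, y, hxy⟩ := G.exists_isLink_of_mem_edgeSet he.1
  obtain ⟨n, p, hp, h0, hn, hl⟩ := (he.2 _ _ hxy).exists_path
  have : Inhabited β := ⟨e⟩
  choose! c hcS hc using hl
  -- The path has edges `c 0, …, c (n - 1)`; position `n` is filled by `e`, which closes it. A loop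
  -- `e` gives `n = 0`.
  let d : ℕ → β := fun i ↦ if i < n then c i else e
  have hd : ∀ i < n, d i = c i := fun i hi ↦ if_pos hi
  have hdn : d n = e := if_neg (lt_irrefl _)
  have hinj : ∀ i < n, ∀ j < n, c i = c j → i = j := by
    intro i hi j hj hij
    have h1 := hc i hi
    rw [hij] at h1
    obtain ⟨h2, -⟩ | ⟨h2, h3⟩ := h1.eq_and_eq_or_eq_and_eq (hc j hj)
    · exact hp (by simp; omega) (by simp; omega) h2
    · have := hp (by simp; omega) (by simp; omega) h2
      have := hp (by simp; omega) (by simp; omega) h3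
      omega
  refine ⟨_, ⟨n, fun i ↦ p i, fun i ↦ d i, ?_, ?_, ?_, rfl⟩, ⟨Fin.last n, by simpa using hdn⟩⟩
  · intro i j hij
    exact Fin.ext (hp (by simp; omega) (by simp; omega) hij)
  · intro i j hij
    have hij : d i = d j := hij
    apply Fin.ext
    rcases Nat.lt_or_eq_of_le (Nat.lt_succ_iff.1 i.2) with hi | hi <;>
      rcases Nat.lt_or_eq_of_le (Nat.lt_succ_iff.1 j.2) with hj | hj
    · rw [hd _ hi, hd _ hj] at hij
      exact hinj _ hi _ hj hij
    · rw [hd _ hi, hj, hdn] at hij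
      exact absurd (hij ▸ hcS _ hi) heS
    · rw [hd _ hj, hi, hdn] at hij
      exact absurd (hij ▸ hcS _ hj) heS
    · omega
  · intro i
    show d i ∈ insert e S ∧ G.IsLink (d i) (p i) (p (i + 1 : Fin (n + 1)))
    rcases Nat.lt_or_eq_of_le (Nat.lt_succ_iff.1 i.2) with hi | hi
    · rw [hd _ hi, Fin.val_add_one_of_lt' (by omega)]
      exact ⟨.inr (hcS _ hi), hc _ hi⟩
    · have : i = Fin.last n := Fin.ext hi
      subst this
      rw [Fin.last_add_one, Fin.val_last, hdn, Fin.val_zero, h0, hn]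
      exact ⟨.inl rfl, hxy.symm⟩

lemma mem_spanningForests_iff : F ∈ spanningForests G ↔ Indep G F := by
  refine and_congr_right fun hF ↦ ⟨fun h e he hc ↦ ?_, fun h C hC ↦ ?_⟩
  · obtain ⟨C, hC, -⟩ := exists_isCycle_of_mem_cl hc (by simp)
    rw [Set.insert_sdiff_singleton, Set.insert_eq_of_mem he] at hC
    exact h C hC
  · obtain ⟨e, he⟩ := hC.nonempty
    exact h e (hC.subset he) (cl_mono (Set.sdiff_subset_sdiff_left hC.subset) (hC.mem_cl he))

/-- If `e` is least in a cycle, the rest of that cycle lies above `e`; conversely, any path through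
larger edges of `F` closes up with `e` to a cycle in which `e` is least. -/
lemma mem_externallyActive_iff [LinearOrder β] :
    e ∈ externallyActive G F ↔ e ∉ F ∧ e ∈ cl G {f | f ∈ F ∧ e < f} := by
  constructor
  · rintro ⟨-, heF, C, hC, hleast⟩
    refine ⟨heF, cl_mono ?_ (hC.mem_cl hleast.1)⟩
    rintro f ⟨hf, hne⟩
    exact ⟨(hC.subset hf).resolve_left hne, lt_of_le_of_ne (hleast.2 hf) (Ne.symm hne)⟩
  · rintro ⟨heF, hc⟩
    obtain ⟨C, hC, heC⟩ := exists_isCycle_of_mem_cl hc (fun h ↦ heF h.1)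
    refine ⟨hc.1, heF, C, hC.mono (Set.insert_subset_insert fun f hf ↦ hf.1), heC, fun f hf ↦ ?_⟩
    rcases hC.subset hf with rfl | hf
    · rfl
    · exact hf.2.le

lemma mem_spanningTrees_iff : T ∈ spanningTrees G ↔ Indep G T ∧ G.edgeSet ⊆ cl G T := by
  refine and_congr mem_spanningForests_iff ⟨fun h e he ↦ ?_, ?_⟩
  · obtain ⟨x, y, hxy⟩ := G.exists_isLink_of_mem_edgeSet he
    have hj := (h (component G x) ⟨x, hxy.left_mem, rfl⟩).2 x Relation.ReflTransGen.refl y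
      (Relation.ReflTransGen.single ⟨e, hxy⟩)
    have hle : ((G.restrict T).induce (component G x)).Adj ≤ (G.restrict T).Adj :=
      fun u v ⟨g, hg⟩ ↦ ⟨g, hg.1⟩
    exact mem_cl_of_joined hxy (Relation.ReflTransGen.mono hle _ _ hj)
  · rintro h _ ⟨v, hv, rfl⟩
    -- A walk in `T` never leaves a component of `G`, so it survives in the induced subgraph.
    have key : ∀ u w, u ∈ component G v → Joined G T u w →
        Relation.ReflTransGen ((G.restrict T).induce (component G v)).Adj u w := by
      intro u w hu hj
      have : w ∈ component G v ∧
          Relation.ReflTransGen ((G.restrict T).induce (component G v)).Adj u w := by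
        induction hj with
        | refl => exact ⟨hu, .refl⟩
        | tail _ hadj ih =>
          obtain ⟨g, hg⟩ := hadj
          have hb := Relation.ReflTransGen.tail ih.1 (⟨g, hg.2⟩ : G.Adj _ _)
          exact ⟨hb, ih.2.tail ⟨g, hg, ih.1, hb⟩⟩
      exact this.2
    refine ⟨⟨v, Relation.ReflTransGen.refl⟩, fun x hx y hy ↦ key x y hx ?_⟩
    have hG : ∀ u, u ∈ component G v → Joined G T v u := by
      intro u hu
      refine Joined.of_subset_cl (A := G.edgeSet) h ?_
      rwa [Joined, Graph.restrict_self]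
    exact (hG x hx).symm.trans (hG y hy)

lemma mem_spanningForests_of_subset (hT : T ∈ spanningTrees G) (hFT : F ⊆ T) :
    F ∈ spanningForests G :=
  mem_spanningForests_iff.2 ((mem_spanningTrees_iff.1 hT).1.subset hFT)

/-- An `f` spanned by `T \ {e}` cannot help to span `e`; any other `f` keeps the set independent and
gives `e` back by exchange. -/
lemma mem_cut_iff (hT : T ∈ spanningTrees G) (he : e ∈ T) :
    f ∈ cut G T e ↔ f ∈ G.edgeSet ∧ f ∉ cl G (T \ {e}) := by
  obtain ⟨hI, hS⟩ := mem_spanningTrees_iff.1 hT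
  refine and_congr_right fun hf ↦ ?_
  rw [mem_spanningTrees_iff]
  constructor
  · rintro ⟨h1, h2⟩ hc
    have hsub : insert f (T \ {e}) ⊆ cl G (T \ {e}) :=
      Set.insert_subset hc (subset_cl (Set.sdiff_subset.trans hI.1))
    exact hI.2 e he (cl_subset_of_subset_cl hsub (h2 (hI.1 he)))
  · intro hc
    refine ⟨(hI.subset Set.sdiff_subset).insert_of_notMem_cl hf hc,
      hS.trans (cl_subset_of_subset_cl fun g hg ↦ ?_)⟩
    by_cases hge : g = e
    · subst hge
      refine cl_exchange (hI.1 he) ?_ hc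
      rw [Set.insert_sdiff_singleton, Set.insert_eq_of_mem he]
      exact hS hf
    · exact subset_cl (Set.insert_subset hf (Set.sdiff_subset.trans hI.1)) (.inr ⟨hg, hge⟩)

lemma mem_internallyInactive_iff [LinearOrder β] (hT : T ∈ spanningTrees G) :
    e ∈ internallyInactive G T ↔ e ∈ T ∧ ∃ f ∈ G.edgeSet, f < e ∧ f ∉ cl G (T \ {e}) := by
  refine and_congr_right fun he ↦ ?_
  have hI := (mem_spanningTrees_iff.1 hT).1
  have hmem : e ∈ cut G T e := (mem_cut_iff hT he).2 ⟨hI.1 he, hI.2 e he⟩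
  simp only [IsLeast, hmem, true_and, mem_lowerBounds, not_forall, mem_cut_iff hT he]
  constructor
  · rintro ⟨f, hf, hlt⟩
    exact ⟨f, hf.1, not_le.1 hlt, hf.2⟩
  · rintro ⟨f, hf, hlt, hc⟩
    exact ⟨f, ⟨hf, hc⟩, not_le.2 hlt⟩

end Cycles

/-! ### Interval partitions defined by the activities. -/

section Activities

variable {α β : Type*} [LinearOrder β] {G : Graph α β} {A B C S F T : Set β} {e f : β}

/-- Every edge set `A` has exactly one spanning forest `F ⊆ A` such that `A` is contained in the
union of `F` and of its externally active edges. -/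
lemma existsUnique_spanningForest (hE : G.edgeSet.Finite) (hA : A ⊆ G.edgeSet) :
    ∃! F, F ∈ spanningForests G ∧ F ⊆ A ∧ A ⊆ F ∪ externallyActive G F := by
  -- The greedy basis of `A`, built from the largest edge downwards.
  set F₀ : Set β := {e | e ∈ A ∧ e ∉ cl G {f | f ∈ A ∧ e < f}} with hF₀
  have hF₀A : F₀ ⊆ A := fun e he ↦ he.1
  have hspan : ∀ e ∈ A, e ∈ cl G {f | f ∈ F₀ ∧ e ≤ f} := by
    intro e he
    refine ((hE.subset hA).wellFoundedOn (r := (· > ·))).induction he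
      (P := fun e ↦ e ∈ cl G {f | f ∈ F₀ ∧ e ≤ f}) fun e he ih ↦ ?_
    by_cases heF : e ∈ F₀
    · exact mem_cl_of_mem (fun f hf ↦ hA hf.1.1) ⟨heF, le_rfl⟩
    · have hc : e ∈ cl G {f | f ∈ A ∧ e < f} := by
        by_contra h
        exact heF ⟨he, h⟩
      refine cl_subset_of_subset_cl (fun g hg ↦ ?_) hc
      exact mem_cl_mono (fun f hf ↦ ⟨hf.1, hg.2.le.trans hf.2⟩) (ih g hg.1 hg.2)
  refine ⟨F₀, ⟨mem_spanningForests_iff.2 ⟨hF₀A.trans hA, fun e he hc ↦ ?_⟩, hF₀A, fun e he ↦ ?_⟩, ?_⟩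
  -- A dependency in `F₀` yields a circuit `insert e P`; its least edge is spanned by larger edges
  -- of `A`, so it was not chosen.
  · obtain ⟨P, hP, heP, hmin⟩ :=
      exists_minimal_subset ((hE.subset (hF₀A.trans hA)).subset Set.sdiff_subset) hc
    have hPF : insert e P ⊆ F₀ := Set.insert_subset he (hP.trans Set.sdiff_subset)
    have hfin : (insert e P).Finite := hE.subset (hPF.trans (hF₀A.trans hA))
    obtain ⟨m, hm, hmle⟩ := hfin.exists_minimalFor id _ (Set.insert_nonempty e P)
    have hmin' : ∀ g ∈ insert e P, m ≤ g := fun g hg ↦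
      (le_total m g).elim id fun h ↦ hmle hg h
    have hcirc : m ∈ cl G (insert e P \ {m}) := by
      rcases hm with rfl | hm
      · refine mem_cl_mono (fun f hf ↦ ⟨.inr hf, (hP hf).2⟩) heP
      · have h1 : m ∈ cl G (insert e (P \ {m})) := by
          refine cl_exchange (hA (hF₀A (hPF (.inr hm)))) ?_ (hmin m hm)
          rwa [Set.insert_sdiff_singleton, Set.insert_eq_of_mem hm]
        refine mem_cl_mono (Set.insert_subset ⟨.inl rfl, fun h ↦ ?_⟩ fun f hf ↦ ⟨.inr hf.1, hf.2⟩) h1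
        exact (hP hm).2 (Eq.symm h)
    refine (hPF hm).2 (mem_cl_mono (fun f hf ↦ ⟨hF₀A (hPF hf.1), ?_⟩) hcirc)
    exact lt_of_le_of_ne (hmin' f hf.1) (Ne.symm hf.2)
  · by_cases heF : e ∈ F₀
    · exact .inl heF
    · refine .inr (mem_externallyActive_iff.2 ⟨heF, mem_cl_mono (fun f hf ↦ ⟨hf.1, ?_⟩) (hspan e he)⟩)
      exact lt_of_le_of_ne hf.2 fun h ↦ heF (h ▸ hf.1)
  · rintro F ⟨hF, hFA, hAF⟩
    have hI := mem_spanningForests_iff.1 hF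
    -- Every edge of `A` is spanned by edges of `F` at least as large, so `F` must satisfy the
    -- greedy criterion too.
    have hcl : ∀ e, e ∈ cl G {f | f ∈ A ∧ e < f} → e ∈ cl G {f | f ∈ F ∧ e < f} := by
      intro e hc
      refine cl_subset_of_subset_cl (fun g hg ↦ ?_) hc
      rcases hAF hg.1 with h | h
      · exact mem_cl_of_mem (fun f hf ↦ hI.1 hf.1) ⟨h, hg.2⟩
      · exact mem_cl_mono (fun f hf ↦ ⟨hf.1, hg.2.trans hf.2⟩) (mem_externallyActive_iff.1 h).2
    ext e
    constructor
    · refine fun he ↦ ⟨hFA he, fun hc ↦ hI.2 e he (mem_cl_mono ?_ (hcl e hc))⟩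
      exact fun f hf ↦ ⟨hf.1, hf.2.ne'⟩
    · rintro ⟨he, hc⟩
      refine (hAF he).resolve_right fun h ↦ hc ?_
      exact mem_cl_mono (fun f hf ↦ ⟨hFA hf.1, hf.2⟩) (mem_externallyActive_iff.1 h).2

lemma subset_cl_of_notMem_internallyInactive (hT : T ∈ spanningTrees G) (he : e ∈ T)
    (h : e ∉ internallyInactive G T) :
    {f | f ∈ G.edgeSet ∧ f < e} ⊆ cl G (T \ {e}) := by
  intro f hf
  by_contra hc
  exact h ((mem_internallyInactive_iff hT).2 ⟨he, f, hf.1, hf.2, hc⟩)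

/-- Every spanning forest lies between the internally inactive edges of a spanning tree and that
spanning tree, for exactly one spanning tree. -/
lemma existsUnique_spanningTree (hE : G.edgeSet.Finite) (hF : F ∈ spanningForests G) :
    ∃! T, T ∈ spanningTrees G ∧ internallyInactive G T ⊆ F ∧ F ⊆ T := by
  have hFI := mem_spanningForests_iff.1 hF
  -- The greedy extension of `F` to a basis, built from the smallest edge upwards.
  set T₀ : Set β := F ∪ {e | e ∈ G.edgeSet ∧ e ∉ cl G (F ∪ {f | f ∈ G.edgeSet ∧ f < e})} with hT₀
  have hT₀E : T₀ ⊆ G.edgeSet := Set.union_subset hFI.1 fun e he ↦ he.1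
  have hspan : ∀ e ∈ G.edgeSet, e ∈ cl G (F ∪ {f | f ∈ T₀ ∧ f ≤ e}) := by
    intro e he
    refine (hE.wellFoundedOn (r := (· < ·))).induction he
      (P := fun e ↦ e ∈ cl G (F ∪ {f | f ∈ T₀ ∧ f ≤ e})) fun e he ih ↦ ?_
    have hsub : F ∪ {f | f ∈ T₀ ∧ f ≤ e} ⊆ G.edgeSet := Set.union_subset hFI.1 fun f hf ↦ hT₀E hf.1
    by_cases heT : e ∈ T₀
    · exact mem_cl_of_mem hsub (.inr ⟨heT, le_rfl⟩)
    · have hc : e ∈ cl G (F ∪ {f | f ∈ G.edgeSet ∧ f < e}) := by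
        by_contra h
        exact heT (.inr ⟨he, h⟩)
      refine cl_subset_of_subset_cl (fun g hg ↦ ?_) hc
      rcases hg with hg | hg
      · exact mem_cl_of_mem hsub (.inl hg)
      · refine mem_cl_mono (Set.union_subset_union_right F fun f hf ↦ ⟨hf.1, ?_⟩) (ih g hg.1 hg.2)
        exact hf.2.trans hg.2.le
  have hindep : Indep G T₀ := by
    refine ⟨hT₀E, fun e he hc ↦ ?_⟩
    obtain ⟨P, hP, heP, hmin⟩ :=
      exists_minimal_subset ((hE.subset hT₀E).subset Set.sdiff_subset) hc
    have hPT : insert e P ⊆ T₀ := Set.insert_subset he (hP.trans Set.sdiff_subset)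
    have hcirc : ∀ m ∈ insert e P, m ∈ cl G (insert e P \ {m}) := by
      rintro m (rfl | hm)
      · refine mem_cl_mono (fun f hf ↦ ⟨.inr hf, (hP hf).2⟩) heP
      · have h1 : m ∈ cl G (insert e (P \ {m})) := by
          refine cl_exchange (hT₀E (hPT (.inr hm))) ?_ (hmin m hm)
          rwa [Set.insert_sdiff_singleton, Set.insert_eq_of_mem hm]
        refine mem_cl_mono (Set.insert_subset ⟨.inl rfl, fun h ↦ ?_⟩ fun f hf ↦ ⟨.inr hf.1, hf.2⟩) h1
        exact (hP hm).2 (Eq.symm h)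
    -- The largest edge of the circuit outside `F` is spanned by `F` and smaller edges, so it was
    -- not added; a circuit inside `F` is impossible.
    by_cases hQ : (insert e P \ F).Nonempty
    · have hfin : (insert e P \ F).Finite := hE.subset (Set.sdiff_subset.trans (hPT.trans hT₀E))
      obtain ⟨m, hm, hmle⟩ := hfin.exists_maximalFor id _ hQ
      refine ((hPT hm.1).resolve_left hm.2).2 (mem_cl_mono (fun f hf ↦ ?_) (hcirc m hm.1))
      by_cases hfF : f ∈ F
      · exact .inl hfF
      · refine .inr ⟨hT₀E (hPT hf.1), lt_of_le_of_ne ?_ hf.2⟩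
        exact (le_total f m).elim id fun h ↦ hmle ⟨hf.1, hfF⟩ h
    · have hPF : insert e P ⊆ F := Set.sdiff_eq_empty.1 (Set.not_nonempty_iff_eq_empty.1 hQ)
      refine hFI.2 e (hPF (.inl rfl)) (mem_cl_mono ?_ (hcirc e (.inl rfl)))
      exact Set.sdiff_subset_sdiff_left hPF
  have hT₀tree : T₀ ∈ spanningTrees G := by
    refine mem_spanningTrees_iff.2 ⟨hindep, fun e he ↦ mem_cl_mono ?_ (hspan e he)⟩
    exact Set.union_subset Set.subset_union_left fun f hf ↦ hf.1
  refine ⟨T₀, ⟨hT₀tree, fun e he ↦ ?_, Set.subset_union_left⟩, ?_⟩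
  -- An `e` added greedily is not needed to span smaller edges: such an `f` lies in the closure of
  -- `F` and the edges of `T₀` up to `f`.
  · obtain ⟨heT, f, hf, hfe, hc⟩ := (mem_internallyInactive_iff hT₀tree).1 he
    by_contra heF
    refine hc (mem_cl_mono ?_ (hspan f hf))
    refine Set.union_subset (fun g hg ↦ ⟨.inl hg, fun h ↦ heF (h ▸ hg)⟩) fun g hg ↦ ⟨hg.1, ?_⟩
    exact (hg.2.trans_lt hfe).ne
  · rintro T ⟨hT, hIF, hFT⟩
    obtain ⟨hI, hS⟩ := mem_spanningTrees_iff.1 hT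
    ext e
    constructor
    · intro he
      by_cases heF : e ∈ F
      · exact .inl heF
      · refine .inr ⟨hI.1 he, fun hc ↦ hI.2 e he (cl_subset_of_subset_cl ?_ hc)⟩
        refine Set.union_subset (fun g hg ↦ ?_)
          (subset_cl_of_notMem_internallyInactive hT he fun h ↦ heF (hIF h))
        exact mem_cl_of_mem (Set.sdiff_subset.trans hI.1) ⟨hFT hg, fun h ↦ heF (h ▸ hg)⟩
    · rintro (he | ⟨he, hc⟩)
      · exact hFT he
      · by_contra heT
        -- The edges outside `F` in the fundamental circuit of `e` are internally active in `T`,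
        -- hence smaller than `e`; so `e` would not have been added.
        refine hc (mem_cl_mono (fun f hf ↦ ?_) (hI.mem_cl_fundamental (hE.subset hI.1) (hS he)))
        by_cases hfF : f ∈ F
        · exact .inl hfF
        · refine .inr ⟨hI.1 hf.1, not_le.1 fun hle ↦ ?_⟩
          rcases hle.eq_or_lt with rfl | hlt
          · exact heT hf.1
          · exact hfF (hIF ((mem_internallyInactive_iff hT).2 ⟨hf.1, e, he, hlt, hf.2⟩))

/-- If `e` is externally active for `T`, each tree edge on its fundamental circuit can be exchanged
for the smaller `e`. It is therefore internally inactive and lies in `F`, so the whole circuit is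
available in `F`. -/
lemma externallyActive_eq_of_subset (hE : G.edgeSet.Finite) (hT : T ∈ spanningTrees G)
    (hIF : internallyInactive G T ⊆ F) (hFT : F ⊆ T) :
    externallyActive G F = externallyActive G T := by
  obtain ⟨hI, hS⟩ := mem_spanningTrees_iff.1 hT
  ext e
  rw [mem_externallyActive_iff, mem_externallyActive_iff]
  constructor
  · rintro ⟨-, hc⟩
    refine ⟨fun heT ↦ hI.2 e heT (mem_cl_mono ?_ hc), mem_cl_mono (fun f hf ↦ ⟨hFT hf.1, hf.2⟩) hc⟩
    exact fun f hf ↦ ⟨hFT hf.1, hf.2.ne'⟩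
  · rintro ⟨heT, hc⟩
    refine ⟨fun h ↦ heT (hFT h), ?_⟩
    have hsub : {f | f ∈ T ∧ e < f} ⊆ T := fun f hf ↦ hf.1
    have hfund := (hI.subset hsub).mem_cl_fundamental (hE.subset (hsub.trans hI.1)) hc
    refine mem_cl_mono (fun f hf ↦ ⟨hIF ?_, hf.1.2⟩) hfund
    refine (mem_internallyInactive_iff hT).2 ⟨hf.1.1, e, hc.1, hf.1.2, fun hc' ↦ ?_⟩
    refine hI.2 f hf.1.1 (cl_subset_of_subset_cl (A := insert e ({f | f ∈ T ∧ e < f} \ {f})) ?_ ?_)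
    · exact Set.insert_subset hc' ((Set.sdiff_subset_sdiff_left hsub).trans
        (subset_cl (Set.sdiff_subset.trans hI.1)))
    · refine cl_exchange (hI.1 hf.1.1) ?_ hf.2
      rwa [Set.insert_sdiff_singleton, Set.insert_eq_of_mem hf.1]

end Activities

/-! ### The random cluster expansion. -/

/-- The weight of the partition of the vertices of `H` into components. -/
noncomputable def componentWeight {α β : Type*} (H : Graph α β) (q : ℕ) (b : ℂ) (z : α → ℂ) : ℂ :=
  ∏ᶠ S ∈ components H, X q b (weightSum z S)

open Classical in
/-- The functions that are constant on the fibres of a surjection `c` are the functions on the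
target of `c`. -/
lemma sum_constant_on_fibres {V K S : Type*} [Fintype V] [Fintype K] [Fintype S]
    [DecidableEq V] [DecidableEq K]
    {c : V → K} (hc : Function.Surjective c) (g : V → S → ℂ) :
    ∑ σ : V → S, (if ∀ i j, c i = c j → σ i = σ j then ∏ i, g i (σ i) else 0) =
      ∏ k, ∑ s, ∏ i with c i = k, g i s := by
  rw [Finset.prod_univ_sum, Fintype.piFinset_univ, ← Finset.sum_filter]
  symm
  refine Finset.sum_bij (fun τ _ ↦ τ ∘ c) ?_ ?_ ?_ ?_
  · intro τ _
    simp only [Finset.mem_filter, Finset.mem_univ, true_and, Function.comp]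
    exact fun i j h ↦ by rw [h]
  · intro τ _ τ' _ h
    exact hc.injective_comp_right h
  · intro σ hσ
    simp only [Finset.mem_filter, Finset.mem_univ, true_and] at hσ
    refine ⟨fun k ↦ σ (Function.surjInv hc k), Finset.mem_univ _, funext fun i ↦ ?_⟩
    exact hσ _ _ (Function.surjInv_eq hc (c i))
  · intro τ _
    rw [← Finset.prod_fiberwise_of_maps_to (s := Finset.univ) (t := Finset.univ) (g := c)
      (fun _ _ ↦ Finset.mem_univ _)]
    refine Finset.prod_congr rfl fun k _ ↦ Finset.prod_congr rfl fun i hi ↦ ?_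
    simp only [Finset.mem_filter, Finset.mem_univ, true_and] at hi
    simp [hi]

section RandomCluster

variable {α β : Type*} {G : Graph α β} {A : Set β} {x y : α}

lemma mem_component_self (G : Graph α β) (x : α) : x ∈ component G x := Relation.ReflTransGen.refl

lemma component_eq_iff : component (G.restrict A) x = component (G.restrict A) y ↔ Joined G A x y := by
  constructor
  · intro h
    have : y ∈ component (G.restrict A) y := mem_component_self _ _
    rwa [← h] at this
  · intro h
    ext w
    exact ⟨fun hw ↦ (Joined.symm h).trans hw, fun hw ↦ Joined.trans h hw⟩

lemma component_subset (hx : x ∈ G.vertexSet) : component (G.restrict A) x ⊆ G.vertexSet :=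
  fun _ h ↦ Joined.mem_vertexSet h hx

lemma components_finite (hV : G.vertexSet.Finite) : (components G).Finite := hV.image _

lemma forall_edgeDelta_iff {q : ℕ} (σ : State G q) :
    (∀ e ∈ A, ∀ i j : G.vertexSet, G.IsLink e i j → σ i = σ j) ↔
      ∀ i j : G.vertexSet, component (G.restrict A) i = component (G.restrict A) j → σ i = σ j := by
  constructor
  · intro h i j hij
    have key : ∀ y, Joined G A i y → ∃ hy : y ∈ G.vertexSet, σ i = σ ⟨y, hy⟩ := by
      intro y hy
      induction hy with
      | refl => exact ⟨i.2, rfl⟩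
      | tail _ hadj ih =>
        obtain ⟨e, he, hl⟩ := restrict_adj.1 hadj
        obtain ⟨hu, ih⟩ := ih
        exact ⟨hl.right_mem, ih.trans (h e he ⟨_, hu⟩ ⟨_, hl.right_mem⟩ hl)⟩
    exact (key j (component_eq_iff.1 hij)).2
  · exact fun h e he i j hl ↦ h i j (component_eq_iff.2 (.of_isLink he hl))

open Classical in
lemma prod_edgeDelta {q : ℕ} (σ : State G q) (A : Finset β) :
    ∏ e ∈ A, edgeDelta σ e =
      if ∀ i j : G.vertexSet, component (G.restrict (A : Set β)) i =
        component (G.restrict (A : Set β)) j → σ i = σ j then 1 else 0 := by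
  rw [← if_congr (forall_edgeDelta_iff σ) rfl rfl]
  simp only [edgeDelta, Finset.mem_coe]
  rw [Finset.prod_ite_zero, Finset.prod_const_one]

open Classical in
lemma weightSum_eq_sum [Fintype G.vertexSet] (z : α → ℂ) {S : Set α} (hS : S ⊆ G.vertexSet) :
    weightSum z S = ∑ i ∈ Finset.univ.filter (fun i : G.vertexSet ↦ (i : α) ∈ S), z i := by
  rw [weightSum, ← finsum_mem_coe_finset]
  symm
  refine finsum_mem_eq_of_bijOn (f := fun i : G.vertexSet ↦ z i) (g := z) Subtype.val ⟨?_, Subtype.val_injective.injOn, ?_⟩ fun _ _ ↦ rfl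
  · intro i hi
    simpa using hi
  · intro x hx
    exact ⟨⟨x, hS hx⟩, by simpa using hx, rfl⟩

/-- Spin 1 contributes `t` and the other `q - 1` spins contribute 1. For `q = 0` the sum would be
empty. -/
lemma sum_spin_weight {q : ℕ} (hq : 1 ≤ q) (t : ℂ) :
    ∑ s : Fin q, (if (s : ℕ) + 1 = 1 then t else 1) = t + q - 1 := by
  obtain ⟨n, rfl⟩ : ∃ n, q = n + 1 := ⟨q - 1, by omega⟩
  rw [Fin.sum_univ_succ]
  simp [add_sub_assoc]

open Classical in
lemma sum_states_eq_componentWeight (hV : G.vertexSet.Finite) [Fintype G.vertexSet] {q : ℕ}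
    (hq : 1 ≤ q) (b : ℂ) (z : α → ℂ) (A : Finset β) :
    ∑ σ : State G q, (∏ e ∈ A, edgeDelta σ e) *
        ∏ i : G.vertexSet, (if (σ i : ℕ) + 1 = 1 then Complex.exp (b * z i) else 1) =
      componentWeight (G.restrict (A : Set β)) q b z := by
  have := (components_finite (G := G.restrict (A : Set β)) hV).fintype
  let c : G.vertexSet → components (G.restrict (A : Set β)) :=
    fun i ↦ ⟨component (G.restrict (A : Set β)) i, ⟨i, i.2, rfl⟩⟩
  have hcc : ∀ i j, c i = c j ↔ component (G.restrict (A : Set β)) i =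
      component (G.restrict (A : Set β)) j := fun i j ↦ Subtype.ext_iff
  have hc : Function.Surjective c := by
    rintro ⟨_, ⟨i, hi, rfl⟩⟩
    exact ⟨⟨i, hi⟩, rfl⟩
  have h := sum_constant_on_fibres hc
    (fun (i : G.vertexSet) (s : Fin q) ↦ if (s : ℕ) + 1 = 1 then Complex.exp (b * z i) else 1)
  rw [componentWeight, ← finprod_set_coe_eq_finprod_mem, finprod_eq_prod_of_fintype]
  refine Eq.trans (Finset.sum_congr rfl fun σ _ ↦ ?_) (h.trans (Finset.prod_congr rfl fun k _ ↦ ?_))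
  · rw [prod_edgeDelta]
    simp only [hcc, ite_mul, one_mul, zero_mul]
  · have hk : (k : Set α) ⊆ G.vertexSet := by
      obtain ⟨_, ⟨i, hi, rfl⟩⟩ := k
      exact component_subset hi
    have hfilter : ∀ i : G.vertexSet, c i = k ↔ (i : α) ∈ (k : Set α) := by
      intro i
      obtain ⟨_, ⟨j, hj, rfl⟩⟩ := k
      refine Subtype.ext_iff.trans (component_eq_iff.trans ?_)
      exact ⟨Joined.symm, fun h ↦ Joined.symm h⟩
    rw [X, ← sum_spin_weight hq, weightSum_eq_sum z hk, Finset.mul_sum, Complex.exp_sum]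
    refine Finset.sum_congr rfl fun s _ ↦ ?_
    simp only [hfilter]
    split_ifs with hs
    · rfl
    · simp

/-- The random cluster expansion of the partition function. -/
theorem Z_eq_sum_powerset (hV : G.vertexSet.Finite) (hE : G.edgeSet.Finite) {q : ℕ} (hq : 1 ≤ q)
    (b : ℂ) (J : β → ℂ) (z : α → ℂ) :
    Z G q b J z = ∑ A ∈ hE.toFinset.powerset, (∏ e ∈ A, (Complex.exp (b * J e) - 1)) *
      componentWeight (G.restrict (A : Set β)) q b z := by
  classical
  have := hV.fintype
  rw [Z, partitionFunction, finsum_eq_sum_of_fintype]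
  have hσ : ∀ σ : State G q, Complex.exp (-b * hamiltonian G J z σ) =
      ∑ A ∈ hE.toFinset.powerset, (∏ e ∈ A, (Complex.exp (b * J e) - 1)) *
        ((∏ e ∈ A, edgeDelta σ e) *
          ∏ i : G.vertexSet, (if (σ i : ℕ) + 1 = 1 then Complex.exp (b * z i) else 1)) := by
    intro σ
    have h1 : -b * hamiltonian G J z σ = ∑ e ∈ hE.toFinset, b * J e * edgeDelta σ e +
        ∑ i : G.vertexSet, b * (z i * spinOneDelta σ i) := by
      rw [hamiltonian, finsum_mem_eq_finite_toFinset_sum _ hE, finsum_eq_sum_of_fintype,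
        ← Finset.mul_sum]
      simp only [mul_assoc, ← Finset.mul_sum]
      ring
    -- The exponential is affine in a quantity that only takes the values 0 and 1.
    have h2 : ∀ e, Complex.exp (b * J e * edgeDelta σ e) =
        1 + (Complex.exp (b * J e) - 1) * edgeDelta σ e := by
      intro e
      unfold edgeDelta
      split_ifs <;> simp
    have h3 : ∀ i : G.vertexSet, Complex.exp (b * (z i * spinOneDelta σ i)) =
        if (σ i : ℕ) + 1 = 1 then Complex.exp (b * z i) else 1 := by
      intro i
      unfold spinOneDelta
      split_ifs <;> simp
    rw [h1, Complex.exp_add, Complex.exp_sum, Complex.exp_sum, Finset.prod_congr rfl fun e _ ↦ h2 e,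
      Finset.prod_congr rfl fun i _ ↦ h3 i, Finset.prod_one_add, Finset.sum_mul]
    simp only [Finset.prod_mul_distrib, mul_assoc]
  rw [Finset.sum_congr rfl fun σ _ ↦ hσ σ, Finset.sum_comm]
  refine Finset.sum_congr rfl fun A _ ↦ ?_
  rw [← Finset.mul_sum, sum_states_eq_componentWeight hV hq]

lemma zeroZ_eq_Z (G : Graph α β) (q : ℕ) (b : ℂ) (J : β → ℂ) : zeroZ G q b J = Z G q b J 0 := by
  have : (hamiltonian G J 0 : State G q → ℂ) = zeroHamiltonian G J := by
    funext σ
    simp [hamiltonian, zeroHamiltonian]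
  rw [zeroZ, Z, this]

lemma componentWeight_zero (hV : G.vertexSet.Finite) (q : ℕ) (b : ℂ) :
    componentWeight G q b 0 = (q : ℂ) ^ (components G).ncard := by
  have hX : X q b 0 = q := by simp [X]
  have hw : ∀ S : Set α, weightSum (0 : α → ℂ) S = 0 := fun S ↦ by simp [weightSum]
  rw [componentWeight, finprod_mem_eq_finite_toFinset_prod _ (components_finite hV)]
  simp [hX, hw, Set.ncard_eq_toFinset_card _ (components_finite hV)]

end RandomCluster

/-! ### Reindexing sums over families of sets. -/

section FiniteSums

/-- A sum over a family of finite sets that is partitioned into the intervals `[L T, U T]`. -/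
lemma sum_eq_sum_intervals {ι β : Type*} [DecidableEq β] {s : Finset (Finset β)} {t : Finset ι}
    {L U : ι → Finset β} (hLU : ∀ T ∈ t, L T ⊆ U T)
    (hs : ∀ T ∈ t, ∀ A, L T ⊆ A → A ⊆ U T → A ∈ s)
    (huniq : ∀ A ∈ s, ∃! T, T ∈ t ∧ L T ⊆ A ∧ A ⊆ U T) (f : Finset β → ℂ) :
    ∑ A ∈ s, f A = ∑ T ∈ t, ∑ D ∈ (U T \ L T).powerset, f (L T ∪ D) := by
  have h : ∀ T ∈ t, ∑ D ∈ (U T \ L T).powerset, f (L T ∪ D) =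
      ∑ A ∈ s with L T ⊆ A ∧ A ⊆ U T, f A := by
    intro T hT
    refine Finset.sum_bij (fun D _ ↦ L T ∪ D) ?_ ?_ ?_ fun _ _ ↦ rfl
    · intro D hD
      rw [Finset.mem_powerset] at hD
      have h1 : L T ∪ D ⊆ U T := Finset.union_subset (hLU T hT) (hD.trans Finset.sdiff_subset)
      exact Finset.mem_filter.2 ⟨hs T hT _ Finset.subset_union_left h1,
        Finset.subset_union_left, h1⟩
    · intro D hD D' hD' hDD
      rw [Finset.mem_powerset] at hD hD'
      refine Finset.ext fun e ↦ ?_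
      have h1 := Finset.ext_iff.1 hDD e
      have h2 := @hD e
      have h3 := @hD' e
      simp only [Finset.mem_union, Finset.mem_sdiff] at h1 h2 h3
      tauto
    · intro A hA
      obtain ⟨-, h1, h2⟩ := Finset.mem_filter.1 hA
      exact ⟨A \ L T, Finset.mem_powerset.2 (Finset.sdiff_subset_sdiff h2 le_rfl),
        Finset.union_sdiff_of_subset h1⟩
  rw [Finset.sum_congr rfl h]
  simp_rw [Finset.sum_filter]
  rw [Finset.sum_comm]
  refine Finset.sum_congr rfl fun A hA ↦ ?_
  obtain ⟨T, ⟨hT, h1⟩, h2⟩ := huniq A hA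
  rw [Finset.sum_eq_single_of_mem T hT, if_pos h1]
  exact fun T' hT' hne ↦ if_neg fun h ↦ hne (h2 T' ⟨hT', h⟩)

open Classical in
lemma finsum_mem_sets_eq_sum {β : Type*} {E : Set β} (hE : E.Finite) {P : Set (Set β)}
    (hP : ∀ F ∈ P, F ⊆ E) (f : Set β → ℂ) :
    ∑ᶠ F ∈ P, f F = ∑ F ∈ hE.toFinset.powerset.filter (fun F : Finset β ↦ (F : Set β) ∈ P), f F := by
  rw [← finsum_mem_coe_finset]
  symm
  refine finsum_mem_eq_of_bijOn (f := fun F : Finset β ↦ f F) (g := f) (fun F : Finset β ↦ (F : Set β))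
    ⟨?_, Finset.coe_injective.injOn, ?_⟩ fun _ _ ↦ rfl
  · intro F hF
    exact (Finset.mem_filter.1 hF).2
  · intro F hF
    refine ⟨(hE.subset (hP F hF)).toFinset, ?_, by simp⟩
    simp [hP F hF, hF]

end FiniteSums

/-! ### The spanning forest expansion. -/

section Forests

variable {α β : Type*} {G : Graph α β} {A B I D T : Set β} {x y : α}

lemma componentWeight_congr (hAB : A ⊆ B) (hBA : B ⊆ cl G A) (q : ℕ) (b : ℂ) (z : α → ℂ) :
    componentWeight (G.restrict B) q b z = componentWeight (G.restrict A) q b z := by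
  have h : component (G.restrict B) = component (G.restrict A) := by
    funext x
    ext y
    exact ⟨Joined.of_subset_cl hBA, Joined.mono hAB⟩
  simp only [componentWeight, components, h, Graph.vertexSet_restrict]

open Classical in
/-- The expansion of the partition function over spanning forests, as a sum over finite sets. -/
lemma Z_eq_sum_spanningForests [LinearOrder β] (hV : G.vertexSet.Finite) (hE : G.edgeSet.Finite)
    {q : ℕ} (hq : 1 ≤ q) (b : ℂ) (J : β → ℂ) (z : α → ℂ) :
    Z G q b J z =
      ∑ F ∈ hE.toFinset.powerset.filter (fun F : Finset β ↦ (F : Set β) ∈ spanningForests G),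
        componentWeight (G.restrict (F : Set β)) q b z * (∏ e ∈ F, (Complex.exp (b * J e) - 1)) *
          ∏ᶠ e ∈ externallyActive G (F : Set β), Complex.exp (b * J e) := by
  have hfin : ∀ F : Set β, (externallyActive G F).Finite := fun F ↦ hE.subset fun e he ↦ he.1
  rw [Z_eq_sum_powerset hV hE hq, sum_eq_sum_intervals
    (t := hE.toFinset.powerset.filter (fun F : Finset β ↦ (F : Set β) ∈ spanningForests G))
    (L := id) (U := fun F ↦ F ∪ (hfin F).toFinset)]
  · refine Finset.sum_congr rfl fun F hF ↦ ?_
    have hF := (Finset.mem_filter.1 hF).2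
    have hdisj : Disjoint F (hfin F).toFinset := by
      refine Finset.disjoint_left.2 fun e he he' ↦ ?_
      exact ((hfin F).mem_toFinset.1 he').2.1 he
    have h1 : (F ∪ (hfin F).toFinset) \ id F = (hfin F).toFinset :=
      Finset.union_sdiff_cancel_left hdisj
    rw [h1, finprod_mem_eq_finite_toFinset_prod _ (hfin F)]
    -- Expanding the product over active edges recovers the sum over the interval above `F`.
    have h2 : ∀ e, Complex.exp (b * J e) = 1 + (Complex.exp (b * J e) - 1) := fun e ↦ by ring
    rw [Finset.prod_congr rfl fun e _ ↦ h2 e, Finset.prod_one_add, Finset.mul_sum]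
    refine Finset.sum_congr rfl fun D hD ↦ ?_
    have hD := Finset.mem_powerset.1 hD
    have h3 : componentWeight (G.restrict ((id F ∪ D : Finset β) : Set β)) q b z =
        componentWeight (G.restrict (F : Set β)) q b z := by
      refine componentWeight_congr (by simp) ?_ q b z
      have hFE : (F : Set β) ⊆ G.edgeSet := hF.1
      intro e he
      rcases Finset.mem_union.1 (Finset.mem_coe.1 he) with he | he
      · exact mem_cl_of_mem hFE he
      · refine mem_cl_mono (fun f hf ↦ hf.1) (mem_externallyActive_iff.1 ?_).2
        exact (hfin F).mem_toFinset.1 (hD he)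
    rw [h3, id, Finset.prod_union (Finset.disjoint_of_subset_right hD hdisj)]
    ring
  · exact fun F _ ↦ Finset.subset_union_left
  · intro F hF A _ hA
    refine Finset.mem_powerset.2 (hA.trans (Finset.union_subset ?_ ?_))
    · exact Finset.mem_powerset.1 (Finset.mem_filter.1 hF).1
    · exact Set.Finite.toFinset_subset_toFinset.2 fun e he ↦ he.1
  · intro A hA
    have hA : (A : Set β) ⊆ G.edgeSet := by
      intro e he
      exact hE.mem_toFinset.1 (Finset.mem_powerset.1 hA he)
    obtain ⟨F, ⟨hF, hFA, hAF⟩, huniq⟩ := existsUnique_spanningForest hE hA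
    have hFfin : F.Finite := hE.subset hF.1
    lift F to Finset β using hFfin
    refine ⟨F, ⟨Finset.mem_filter.2 ⟨?_, hF⟩, Finset.coe_subset.1 hFA, ?_⟩, ?_⟩
    · exact Finset.mem_powerset.2 fun e he ↦ hE.mem_toFinset.2 (hF.1 he)
    · rw [← Finset.coe_subset]
      simpa using hAF
    · rintro F' ⟨hF', hFA', hAF'⟩
      refine Finset.coe_injective (huniq F' ⟨(Finset.mem_filter.1 hF').2, Finset.coe_subset.2 hFA', ?_⟩)
      rw [← Finset.coe_subset] at hAF'
      simpa using hAF'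

theorem Z_eq_finsum_spanningForests [LinearOrder β] (hV : G.vertexSet.Finite)
    (hE : G.edgeSet.Finite) {q : ℕ} (hq : 1 ≤ q) (b : ℂ) (J : β → ℂ) (z : α → ℂ) :
    Z G q b J z =
      ∑ᶠ F ∈ spanningForests G,
        (∏ᶠ S ∈ components (G.restrict F), X q b (weightSum z S)) *
          (∏ᶠ e ∈ F, (Complex.exp (b * J e) - 1)) *
            ∏ᶠ e ∈ externallyActive G F, Complex.exp (b * J e) := by
  rw [finsum_mem_sets_eq_sum hE fun F hF ↦ hF.1, Z_eq_sum_spanningForests hV hE hq]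
  simp only [finprod_mem_coe_finset]
  rfl

end Forests

/-! ### Contractions and the spanning tree expansion. -/

section Contraction

variable {α β : Type*} {G : Graph α β} {I D T : Set β} {v : α}

lemma contract_restrict_isLink (hIT : I ⊆ T) {e : β} {P Q : Set α} :
    (contract (G.restrict T) I).IsLink e P Q ↔ e ∈ T \ I ∧ ∃ x y, G.IsLink e x y ∧
      component (G.restrict I) x = P ∧ component (G.restrict I) y = Q := by
  rw [contract, Graph.restrict_restrict, Set.inter_eq_right.2 hIT]
  simp only [Graph.map_isLink, Relation.map_apply, Graph.deleteEdges_isLink, Graph.restrict_isLink]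
  constructor
  · rintro ⟨x, y, h, h1, h2⟩
    exact ⟨⟨by tauto, by tauto⟩, x, y, by tauto, h1, h2⟩
  · rintro ⟨⟨h1, h2⟩, x, y, h3, h4, h5⟩
    exact ⟨x, y, by tauto, h4, h5⟩

/-- Under contraction, a step along `I` stays at the same merged vertex and a step along `D` becomes
an edge of the contraction. -/
lemma component_contract (hIT : I ⊆ T) (hD : D ⊆ T \ I) (v : α) :
    component ((contract (G.restrict T) I).restrict D) (component (G.restrict I) v) =
      component (G.restrict I) '' component (G.restrict (I ∪ D)) v := by
  ext P
  constructor
  · intro h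
    induction h with
    | refl => exact ⟨v, mem_component_self _ _, rfl⟩
    | tail _ hadj ih =>
      obtain ⟨w, hw, rfl⟩ := ih
      obtain ⟨e, he, hl⟩ := restrict_adj.1 hadj
      obtain ⟨-, x, y, hxy, hx, rfl⟩ := (contract_restrict_isLink hIT).1 hl
      have h1 : Joined G (I ∪ D) w x := (component_eq_iff.1 hx.symm).mono Set.subset_union_left
      exact ⟨y, (Joined.trans hw h1).trans (.of_isLink (.inr he) hxy), rfl⟩
  · rintro ⟨w, hw, rfl⟩
    replace hw : Joined G (I ∪ D) v w := hw
    induction hw with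
    | refl => exact mem_component_self _ _
    | @tail u w _ hadj ih =>
      obtain ⟨e, he, hl⟩ := restrict_adj.1 hadj
      rcases he with he | he
      · rwa [← component_eq_iff.2 (Joined.of_isLink he hl)]
      · refine Relation.ReflTransGen.tail ih (restrict_adj.2 ⟨e, he, ?_⟩)
        exact (contract_restrict_isLink hIT).2 ⟨hD he, u, w, hl, rfl, rfl⟩

/-- The components of `(V, I)` partition each component of `(V, I ∪ D)`, so the fields may be added
in two stages. -/
lemma weightSum_weightSum (hV : G.vertexSet.Finite) (hv : v ∈ G.vertexSet) (z : α → ℂ) :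
    weightSum (weightSum z) (component (G.restrict I) '' component (G.restrict (I ∪ D)) v) =
      weightSum z (component (G.restrict (I ∪ D)) v) := by
  set S := component (G.restrict (I ∪ D)) v with hS
  have hSV : S ⊆ G.vertexSet := component_subset hv
  have hsub : ∀ x ∈ S, component (G.restrict I) x ⊆ S := fun x hx y hy ↦
    Joined.trans hx (Joined.mono Set.subset_union_left hy)
  have hU : S = ⋃₀ (component (G.restrict I) '' S) := by
    refine Set.Subset.antisymm (fun x hx ↦ ?_) (Set.sUnion_subset ?_)
    · exact ⟨_, ⟨x, hx, rfl⟩, mem_component_self _ _⟩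
    · rintro _ ⟨x, hx, rfl⟩
      exact hsub x hx
  have h := finsum_mem_sUnion (f := z) (t := component (G.restrict I) '' S) ?_
    ((hV.subset hSV).image _) ?_
  · rw [← hU] at h
    exact h.symm
  · rintro _ ⟨x, hx, rfl⟩ _ ⟨y, hy, rfl⟩ hne
    refine Set.disjoint_left.2 fun w hw hw' ↦ hne (component_eq_iff.2 ?_)
    exact Joined.trans hw (Joined.symm hw')
  · rintro _ ⟨x, hx, rfl⟩
    exact hV.subset ((hsub x hx).trans hSV)

lemma componentWeight_contract (hV : G.vertexSet.Finite) (hIT : I ⊆ T) (hD : D ⊆ T \ I) (q : ℕ)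
    (b : ℂ) (z : α → ℂ) :
    componentWeight ((contract (G.restrict T) I).restrict D) q b (weightSum z) =
      componentWeight (G.restrict (I ∪ D)) q b z := by
  symm
  refine finprod_mem_eq_of_bijOn (Set.image (component (G.restrict I))) ⟨?_, ?_, ?_⟩ ?_
  · rintro _ ⟨v, hv, rfl⟩
    refine ⟨component (G.restrict I) v, ?_, component_contract hIT hD v⟩
    simp only [contract, Graph.restrict_restrict, Set.inter_eq_right.2 hIT]
    exact ⟨v, hv, rfl⟩
  · rintro _ ⟨v, hv, rfl⟩ _ ⟨w, hw, rfl⟩ h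
    have h1 : component (G.restrict I) v ∈
        component (G.restrict I) '' component (G.restrict (I ∪ D)) w := by
      rw [← h]
      exact ⟨v, mem_component_self _ _, rfl⟩
    obtain ⟨u, hu, huv⟩ := h1
    refine component_eq_iff.2 (Joined.symm (Joined.trans hu ?_))
    exact (component_eq_iff.1 huv).mono Set.subset_union_left
  · rintro _ ⟨P, hP, rfl⟩
    simp only [contract, Graph.restrict_restrict, Set.inter_eq_right.2 hIT] at hP
    obtain ⟨v, hv, rfl⟩ := hP
    exact ⟨_, ⟨v, hv, rfl⟩, (component_contract hIT hD v).symm⟩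
  · rintro _ ⟨v, hv, rfl⟩
    rw [weightSum_weightSum hV hv]

lemma contract_vertexSet_finite (hV : G.vertexSet.Finite) : (contract G I).vertexSet.Finite :=
  hV.image _

lemma contract_edgeSet : (contract G I).edgeSet = G.edgeSet \ I := by
  simp [contract]

theorem Z_eq_finsum_spanningTrees [LinearOrder β] (hV : G.vertexSet.Finite)
    (hE : G.edgeSet.Finite) {q : ℕ} (hq : 1 ≤ q) (b : ℂ) (J : β → ℂ) (z : α → ℂ) :
    Z G q b J z =
      ∑ᶠ T ∈ spanningTrees G,
        (∏ᶠ e ∈ internallyInactive G T, (Complex.exp (b * J e) - 1)) *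
          (∏ᶠ e ∈ externallyActive G T, Complex.exp (b * J e)) *
            Z (contract (G.restrict T) (internallyInactive G T)) q b J (weightSum z) := by
  classical
  have hIT : ∀ T : Set β, internallyInactive G T ⊆ T := fun T e he ↦ he.1
  have hfin : ∀ T : Finset β, (internallyInactive G (T : Set β)).Finite :=
    fun T ↦ T.finite_toSet.subset (hIT T)
  rw [finsum_mem_sets_eq_sum hE fun T hT ↦ hT.1.1, Z_eq_sum_spanningForests hV hE hq,
    sum_eq_sum_intervals
      (t := hE.toFinset.powerset.filter (fun T : Finset β ↦ (T : Set β) ∈ spanningTrees G))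
      (L := fun T ↦ (hfin T).toFinset) (U := id)]
  · refine Finset.sum_congr rfl fun T hT ↦ ?_
    have hT := (Finset.mem_filter.1 hT).2
    set I := (hfin T).toFinset with hI
    have hIc : internallyInactive G (T : Set β) = I := by simp [hI]
    have hIT' : (I : Set β) ⊆ T := hIc ▸ hIT T
    have hedge : (contract (G.restrict (T : Set β)) (I : Set β)).edgeSet = ((T \ I : Finset β) : Set β) := by
      rw [contract_edgeSet, Graph.edgeSet_restrict, Set.inter_eq_right.2 hT.1.1, Finset.coe_sdiff]
    have hCE : (contract (G.restrict (T : Set β)) (I : Set β)).edgeSet.Finite := by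
      rw [hedge]
      exact Finset.finite_toSet _
    have hCE' : hCE.toFinset = T \ I := by
      rw [← Finset.coe_inj, hCE.coe_toFinset, hedge]
    -- Subsets `D` of `T \ I` index both the forests `I ∪ D` of the interval and the random cluster
    -- terms of the contraction.
    rw [hIc, finprod_mem_coe_finset, Z_eq_sum_powerset
      (contract_vertexSet_finite (G := G.restrict (T : Set β)) hV) hCE hq, hCE', Finset.mul_sum]
    refine Finset.sum_congr rfl fun D hD ↦ ?_
    have hD := Finset.mem_powerset.1 hD
    have hDs : (D : Set β) ⊆ T \ I := by
      rw [← Finset.coe_sdiff]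
      exact Finset.coe_subset.2 hD
    have hdisj : Disjoint I D := Finset.disjoint_of_subset_right hD Finset.disjoint_sdiff
    have hsub : ((I ∪ D : Finset β) : Set β) ⊆ T := by
      rw [Finset.coe_union]
      exact Set.union_subset hIT' (hDs.trans Set.sdiff_subset)
    rw [componentWeight_contract hV hIT' hDs, Finset.prod_union hdisj,
      externallyActive_eq_of_subset hE hT _ hsub, Finset.coe_union]
    · ring
    · rw [hIc, Finset.coe_union]
      exact Set.subset_union_left
  · exact fun T _ ↦ Finset.coe_subset.1 (by simpa using hIT T)
  · intro T hT F _ hFT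
    obtain ⟨hTE, hT⟩ := Finset.mem_filter.1 hT
    refine Finset.mem_filter.2 ⟨Finset.mem_powerset.2 (hFT.trans (Finset.mem_powerset.1 hTE)), ?_⟩
    exact mem_spanningForests_of_subset hT (Finset.coe_subset.2 hFT)
  · intro F hF
    obtain ⟨T, ⟨hT, hIF, hFT⟩, huniq⟩ := existsUnique_spanningTree hE (Finset.mem_filter.1 hF).2
    have hTfin : T.Finite := hE.subset hT.1.1
    lift T to Finset β using hTfin
    refine ⟨T, ⟨Finset.mem_filter.2 ⟨?_, hT⟩, ?_, Finset.coe_subset.1 hFT⟩, ?_⟩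
    · exact Finset.mem_powerset.2 fun e he ↦ hE.mem_toFinset.2 (hT.1.1 he)
    · rw [← Finset.coe_subset]
      simpa using hIF
    · rintro T' ⟨hT', hIF', hFT'⟩
      refine Finset.coe_injective (huniq T' ⟨(Finset.mem_filter.1 hT').2, ?_, Finset.coe_subset.2 hFT'⟩)
      rw [← Finset.coe_subset] at hIF'
      simpa using hIF'

end Contraction

/-! ### The zero field polynomial and its linear coefficient. -/

section ZeroPolynomial

variable {α β : Type*} {H : Graph α β}

/-- The random cluster expansion of the zero field partition function as a polynomial in the number
of spins. -/
noncomputable def clusterPolynomial (hE : H.edgeSet.Finite) (b : ℂ) (J : β → ℂ) : Polynomial ℂ :=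
  ∑ A ∈ hE.toFinset.powerset, Polynomial.C (∏ e ∈ A, (Complex.exp (b * J e) - 1)) *
    Polynomial.X ^ (components (H.restrict (A : Set β))).ncard

lemma isZeroPolynomial_clusterPolynomial (hV : H.vertexSet.Finite) (hE : H.edgeSet.Finite) (b : ℂ)
    (J : β → ℂ) : IsZeroPolynomial H b J (clusterPolynomial hE b J) := by
  intro q hq
  rw [zeroZ_eq_Z, Z_eq_sum_powerset hV hE hq, clusterPolynomial, Polynomial.eval_finsetSum]
  refine Finset.sum_congr rfl fun A _ ↦ ?_
  rw [componentWeight_zero (G := H.restrict (A : Set β)) hV, Polynomial.eval_mul,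
    Polynomial.eval_C, Polynomial.eval_pow, Polynomial.eval_X]

lemma IsZeroPolynomial.unique {b : ℂ} {J : β → ℂ} {P Q : Polynomial ℂ}
    (hP : IsZeroPolynomial H b J P) (hQ : IsZeroPolynomial H b J Q) : P = Q := by
  refine Polynomial.eq_of_infinite_eval_eq P Q ?_
  have hinj : Function.Injective fun n : ℕ ↦ ((n + 1 : ℕ) : ℂ) := fun m n h ↦ by
    simpa using h
  refine (Set.infinite_range_of_injective hinj).mono ?_
  rintro _ ⟨n, rfl⟩
  exact (hP (n + 1) (by omega)).trans (hQ (n + 1) (by omega)).symm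

lemma zeroPolynomial_eq (hV : H.vertexSet.Finite) (hE : H.edgeSet.Finite) (b : ℂ) (J : β → ℂ) :
    zeroPolynomial H b J = clusterPolynomial hE b J :=
  (Classical.epsilon_spec (p := IsZeroPolynomial H b J)
    ⟨_, isZeroPolynomial_clusterPolynomial hV hE b J⟩).unique
    (isZeroPolynomial_clusterPolynomial hV hE b J)

lemma ncard_components_eq_one_iff {A : Set β} (hne : H.vertexSet.Nonempty) :
    (components (H.restrict A)).ncard = 1 ↔ components (H.restrict A) = {H.vertexSet} := by
  rw [Set.ncard_eq_one]
  refine ⟨fun ⟨S, hS⟩ ↦ ?_, fun h ↦ ⟨_, h⟩⟩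
  have hmem : ∀ x ∈ H.vertexSet, component (H.restrict A) x = S := by
    intro x hx
    have : component (H.restrict A) x ∈ components (H.restrict A) := ⟨x, hx, rfl⟩
    rwa [hS] at this
  rw [hS]
  congr 1
  obtain ⟨v, hv⟩ := hne
  refine Set.Subset.antisymm (hmem v hv ▸ component_subset hv) fun x hx ↦ ?_
  exact hmem x hx ▸ mem_component_self _ _

open Classical in
lemma coeff_zeroPolynomial (hV : H.vertexSet.Finite) (hne : H.vertexSet.Nonempty)
    (hE : H.edgeSet.Finite) (b : ℂ) (J : β → ℂ) :
    (zeroPolynomial H b J).coeff 1 =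
      ∑ A ∈ hE.toFinset.powerset.filter
        (fun A : Finset β ↦ components (H.restrict (A : Set β)) = {H.vertexSet}),
        ∏ e ∈ A, (Complex.exp (b * J e) - 1) := by
  rw [zeroPolynomial_eq hV hE, clusterPolynomial, Polynomial.finsetSum_coeff, Finset.sum_filter]
  refine Finset.sum_congr rfl fun A _ ↦ ?_
  rw [Polynomial.coeff_C_mul, Polynomial.coeff_X_pow, mul_ite, mul_one, mul_zero]
  exact if_congr (eq_comm.trans (ncard_components_eq_one_iff hne)) rfl rfl

end ZeroPolynomial

/-! ### The connected partition expansion. -/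

section Partitions

variable {α β : Type*} {G : Graph α β} {A : Set β} {B B' : Set α} {e : β} {x y : α}

lemma mem_edgeSet_induce_iff (h : G.IsLink e x y) :
    e ∈ (G.induce B).edgeSet ↔ x ∈ B ∧ y ∈ B := by
  constructor
  · intro he
    obtain ⟨u, v, huv⟩ := (G.induce B).exists_isLink_of_mem_edgeSet he
    rw [Graph.induce_isLink] at huv
    obtain ⟨rfl, rfl⟩ | ⟨rfl, rfl⟩ := h.eq_and_eq_or_eq_and_eq huv.1 <;> tauto
  · intro hB
    exact Graph.IsLink.edge_mem (G := G.induce B) ⟨h, hB⟩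

lemma edgeSet_induce_subset : (G.induce B).edgeSet ⊆ G.edgeSet := by
  intro e he
  obtain ⟨u, v, huv⟩ := (G.induce B).exists_isLink_of_mem_edgeSet he
  exact huv.1.edge_mem

lemma Joined.induce (hB : ∀ e ∈ A, ∀ u v, G.IsLink e u v → u ∈ B → v ∈ B) (hx : x ∈ B)
    (h : Joined G A x y) : y ∈ B ∧ Joined (G.induce B) (A ∩ (G.induce B).edgeSet) x y := by
  induction h with
  | refl => exact ⟨hx, .refl _⟩
  | tail _ hadj ih =>
    obtain ⟨e, he, hl⟩ := restrict_adj.1 hadj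
    have hv := hB e he _ _ hl ih.1
    refine ⟨hv, ih.2.trans (.of_isLink (e := e) ⟨he, ?_⟩ ⟨hl, ih.1, hv⟩)⟩
    exact (mem_edgeSet_induce_iff hl).2 ⟨ih.1, hv⟩

lemma mem_of_mem_components (hB : B ∈ components (G.restrict A)) (he : e ∈ A)
    (hl : G.IsLink e x y) (hx : x ∈ B) : y ∈ B := by
  obtain ⟨v, -, rfl⟩ := hB
  exact Joined.trans hx (.of_isLink he hl)

lemma joined_of_mem_components (hB : B ∈ components (G.restrict A)) (hx : x ∈ B) (hy : y ∈ B) :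
    Joined G A x y := by
  obtain ⟨v, -, rfl⟩ := hB
  exact (Joined.symm hx).trans hy

lemma nonempty_of_mem_components (hB : B ∈ components G) : B.Nonempty := by
  obtain ⟨v, -, rfl⟩ := hB
  exact ⟨v, mem_component_self _ _⟩

lemma joined_induce_of_mem_components (hB : B ∈ components (G.restrict A)) (hx : x ∈ B)
    (hy : y ∈ B) : Joined (G.induce B) (A ∩ (G.induce B).edgeSet) x y :=
  ((joined_of_mem_components hB hx hy).induce
    (fun _ he _ _ hl hu ↦ mem_of_mem_components hB he hl hu) hx).2

lemma isConnected_induce_of_mem_components (hB : B ∈ components (G.restrict A)) :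
    IsConnected (G.induce B) := by
  refine ⟨nonempty_of_mem_components hB, fun x hx y hy ↦ ?_⟩
  have hle : ((G.induce B).restrict (A ∩ (G.induce B).edgeSet)).Adj ≤ (G.induce B).Adj :=
    fun u v ⟨g, hg⟩ ↦ ⟨g, hg.2⟩
  exact Relation.ReflTransGen.mono hle _ _ (joined_induce_of_mem_components hB hx hy)

lemma components_induce_of_mem_components (hB : B ∈ components (G.restrict A)) :
    components ((G.induce B).restrict (A ∩ (G.induce B).edgeSet)) = {B} := by
  have h : ∀ x ∈ B, component ((G.induce B).restrict (A ∩ (G.induce B).edgeSet)) x = B :=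
    fun x hx ↦ Set.Subset.antisymm (component_subset (G := G.induce B) hx)
      fun y hy ↦ joined_induce_of_mem_components hB hx hy
  obtain ⟨v, hv⟩ := nonempty_of_mem_components hB
  refine Set.Subset.antisymm ?_ (Set.singleton_subset_iff.2 ⟨v, hv, h v hv⟩)
  rintro _ ⟨x, hx, rfl⟩
  exact h x hx

lemma exists_mem_parts (π : Finpartition G.vertexSet) (hx : x ∈ G.vertexSet) :
    ∃ B ∈ π.parts, x ∈ B := by
  have h := π.sup_parts
  rw [Finset.sup_set_eq_biUnion] at h
  rw [← h] at hx
  simpa using hx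

lemma eq_of_mem_parts (π : Finpartition G.vertexSet) (hB : B ∈ π.parts) (hB' : B' ∈ π.parts)
    (hx : x ∈ B) (hx' : x ∈ B') : B = B' :=
  π.disjoint.elim hB hB' (Set.not_disjoint_iff.2 ⟨x, hx, hx'⟩)

lemma eq_of_mem_edgeSet_induce (π : Finpartition G.vertexSet) (hB : B ∈ π.parts)
    (hB' : B' ∈ π.parts) (he : e ∈ (G.induce B).edgeSet) (he' : e ∈ (G.induce B').edgeSet) :
    B = B' := by
  obtain ⟨x, y, hl⟩ := G.exists_isLink_of_mem_edgeSet (edgeSet_induce_subset he)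
  exact eq_of_mem_parts π hB hB' ((mem_edgeSet_induce_iff hl).1 he).1
    ((mem_edgeSet_induce_iff hl).1 he').1

/-- The partition of the vertices of `G` into the components of a spanning subgraph. -/
noncomputable def componentPartition (hV : G.vertexSet.Finite) (A : Set β) :
    Finpartition G.vertexSet where
  parts := (components_finite (G := G.restrict A) hV).toFinset
  supIndep := by
    rw [Finset.supIndep_iff_pairwiseDisjoint]
    intro B hB B' hB' hne
    simp only [Set.Finite.coe_toFinset] at hB hB'
    obtain ⟨v, hv, rfl⟩ := hB
    obtain ⟨w, hw, rfl⟩ := hB'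
    refine Set.disjoint_left.2 fun u hu hu' ↦ hne (component_eq_iff.2 ?_)
    exact Joined.trans hu (Joined.symm hu')
  sup_parts := by
    rw [Finset.sup_set_eq_biUnion]
    ext x
    simp only [Set.Finite.mem_toFinset, Set.mem_iUnion, id, exists_prop]
    constructor
    · rintro ⟨_, ⟨v, hv, rfl⟩, hx⟩
      exact component_subset (G := G) hv hx
    · exact fun hx ↦ ⟨_, ⟨x, hx, rfl⟩, mem_component_self _ _⟩
  bot_notMem h := by
    obtain ⟨x, hx⟩ := nonempty_of_mem_components ((Set.Finite.mem_toFinset _).1 h)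
    exact hx

lemma coe_parts_componentPartition (hV : G.vertexSet.Finite) (A : Set β) :
    ((componentPartition hV A).parts : Set (Set α)) = components (G.restrict A) := by
  simp [componentPartition]

/-- Gluing: edges inside blocks never leave a block, and `p B` already connects all of `B`. -/
lemma components_eq_parts (π : Finpartition G.vertexSet) {p : π.parts → Set β}
    (hpE : ∀ B : π.parts, p B ⊆ (G.induce (B : Set α)).edgeSet)
    (hp : ∀ B : π.parts, components ((G.induce (B : Set α)).restrict (p B)) = {(B : Set α)}) :
    components (G.restrict (⋃ B : π.parts, p B)) = π.parts := by
  have key : ∀ B ∈ π.parts, ∀ v ∈ B, component (G.restrict (⋃ B : π.parts, p B)) v = B := by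
    intro B hB v hv
    refine Set.Subset.antisymm (fun y hy ↦ ?_) fun y hy ↦ ?_
    · refine (Joined.induce (fun e he u w hl hu ↦ ?_) hv hy).1
      obtain ⟨B', he⟩ := Set.mem_iUnion.1 he
      have h := (mem_edgeSet_induce_iff hl).1 (hpE B' he)
      exact eq_of_mem_parts π hB B'.2 hu h.1 ▸ h.2
    · have hc : component ((G.induce B).restrict (p ⟨B, hB⟩)) v = B := by
        have : component ((G.induce B).restrict (p ⟨B, hB⟩)) v ∈
            components ((G.induce B).restrict (p ⟨B, hB⟩)) := ⟨v, hv, rfl⟩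
        rw [hp ⟨B, hB⟩] at this
        exact this
      rw [← hc] at hy
      have hle : ((G.induce B).restrict (p ⟨B, hB⟩)).Adj ≤ (G.restrict (⋃ B : π.parts, p B)).Adj :=
        fun u v ⟨g, hg⟩ ↦ ⟨g, Set.mem_iUnion.2 ⟨_, hg.1⟩, hg.2.1⟩
      exact Relation.ReflTransGen.mono hle _ _ hy
  ext B
  constructor
  · rintro ⟨v, hv, rfl⟩
    obtain ⟨B, hB, hvB⟩ := exists_mem_parts π hv
    rw [key B hB v hvB]
    exact hB
  · intro hB
    obtain ⟨v, hv⟩ := Set.nonempty_iff_ne_empty.2 (π.ne_bot hB)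
    exact ⟨v, π.le hB hv, key B hB v hv⟩

-- The bijection sends a family of edge sets, one in each block, to its union; the inverse cuts `A`
-- down to the edges inside each block. If some block is not connected, both sides vanish.
open Classical in
lemma sum_filter_components_eq_prod (hV : G.vertexSet.Finite) (hE : G.edgeSet.Finite) (b : ℂ)
    (J : β → ℂ) (π : Finpartition G.vertexSet) :
    ∑ A ∈ hE.toFinset.powerset.filter
        (fun A : Finset β ↦ components (G.restrict (A : Set β)) = π.parts),
        ∏ e ∈ A, (Complex.exp (b * J e) - 1) =
      ∏ B ∈ π.parts, (zeroPolynomial (G.induce B) b J).coeff 1 := by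
  have hEB : ∀ B : Set α, (G.induce B).edgeSet.Finite := fun B ↦ hE.subset edgeSet_induce_subset
  have hcoeff : ∀ B : π.parts, (zeroPolynomial (G.induce (B : Set α)) b J).coeff 1 =
      ∑ A ∈ (hEB B).toFinset.powerset.filter (fun A : Finset β ↦
        components ((G.induce (B : Set α)).restrict (A : Set β)) = {(B : Set α)}),
        ∏ e ∈ A, (Complex.exp (b * J e) - 1) := fun B ↦
    coeff_zeroPolynomial (H := G.induce (B : Set α)) (hV.subset (π.le B.2))
      (Set.nonempty_iff_ne_empty.2 (π.ne_bot B.2)) (hEB B) b J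
  rw [← Finset.prod_coe_sort, Finset.prod_congr rfl fun B _ ↦ hcoeff B, Finset.prod_univ_sum]
  symm
  refine Finset.sum_bij' (fun p _ ↦ Finset.univ.biUnion p)
    (fun A _ B ↦ A.filter (· ∈ (G.induce (B : Set α)).edgeSet)) ?_ ?_ ?_ ?_ ?_
  · intro p hp
    simp only [Fintype.mem_piFinset, Finset.mem_filter, Finset.mem_powerset] at hp
    have hpE : ∀ B : π.parts, (p B : Set β) ⊆ (G.induce (B : Set α)).edgeSet := fun B e he ↦
      (hEB B).mem_toFinset.1 ((hp B).1 he)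
    refine Finset.mem_filter.2 ⟨Finset.mem_powerset.2 fun e he ↦ ?_, ?_⟩
    · obtain ⟨B, -, he⟩ := Finset.mem_biUnion.1 he
      exact hE.mem_toFinset.2 (edgeSet_induce_subset (hpE B he))
    · have := components_eq_parts π (p := fun B ↦ (p B : Set β)) hpE fun B ↦ (hp B).2
      simpa using this
  · intro A hA
    obtain ⟨hAE, hA⟩ := Finset.mem_filter.1 hA
    simp only [Fintype.mem_piFinset, Finset.mem_filter, Finset.mem_powerset]
    refine fun B ↦ ⟨fun e he ↦ (hEB B).mem_toFinset.2 (Finset.mem_filter.1 he).2, ?_⟩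
    have h : (B : Set α) ∈ components (G.restrict (A : Set β)) := hA ▸ B.2
    rw [Finset.coe_filter]
    exact components_induce_of_mem_components h
  · intro p hp
    simp only [Fintype.mem_piFinset, Finset.mem_filter, Finset.mem_powerset] at hp
    funext B
    ext e
    simp only [Finset.mem_filter, Finset.mem_biUnion, Finset.mem_univ, true_and]
    constructor
    · rintro ⟨⟨B', he⟩, heB⟩
      have h := eq_of_mem_edgeSet_induce π B.2 B'.2 heB ((hEB B').mem_toFinset.1 ((hp B').1 he))
      rwa [Subtype.ext h]
    · exact fun he ↦ ⟨⟨B, he⟩, (hEB B).mem_toFinset.1 ((hp B).1 he)⟩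
  · intro A hA
    obtain ⟨hAE, hA⟩ := Finset.mem_filter.1 hA
    ext e
    simp only [Finset.mem_filter, Finset.mem_biUnion, Finset.mem_univ, true_and]
    refine ⟨fun ⟨_, h⟩ ↦ h.1, fun he ↦ ?_⟩
    obtain ⟨x, y, hl⟩ := G.exists_isLink_of_mem_edgeSet
      (hE.mem_toFinset.1 (Finset.mem_powerset.1 hAE he))
    obtain ⟨B, hB, hx⟩ := exists_mem_parts π hl.left_mem
    have h : B ∈ components (G.restrict (A : Set β)) := hA ▸ hB
    exact ⟨⟨B, hB⟩, he, (mem_edgeSet_induce_iff hl).2 ⟨hx, mem_of_mem_components h he hl hx⟩⟩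
  · intro p hp
    simp only [Fintype.mem_piFinset, Finset.mem_filter, Finset.mem_powerset] at hp
    rw [Finset.prod_biUnion]
    intro B _ B' _ hne
    refine Finset.disjoint_left.2 fun e he he' ↦ hne (Subtype.ext ?_)
    exact eq_of_mem_edgeSet_induce π B.2 B'.2 ((hEB B).mem_toFinset.1 ((hp B).1 he))
      ((hEB B').mem_toFinset.1 ((hp B').1 he'))

lemma finpartition_finite (hV : G.vertexSet.Finite) : Finite (Finpartition G.vertexSet) := by
  have hfin : {P : Set (Set α) | P ⊆ {B | B ⊆ G.vertexSet}}.Finite :=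
    hV.finite_subsets.finite_subsets
  have := hfin.to_subtype
  refine Finite.of_injective (β := {P : Set (Set α) | P ⊆ {B | B ⊆ G.vertexSet}})
    (fun π ↦ ⟨(π.parts : Set (Set α)), fun B hB ↦ π.le hB⟩) fun π π' h ↦ ?_
  exact Finpartition.ext (Finset.coe_injective (Subtype.ext_iff.1 h))

theorem Z_eq_finsum_connectedPartitions (hV : G.vertexSet.Finite) (hE : G.edgeSet.Finite) {q : ℕ}
    (hq : 1 ≤ q) (b : ℂ) (J : β → ℂ) (z : α → ℂ) :
    Z G q b J z =
      ∑ᶠ π ∈ connectedPartitions G,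
        (∏ B ∈ π.parts, X q b (weightSum z B)) *
          ∏ B ∈ π.parts, (zeroPolynomial (G.induce B) b J).coeff 1 := by
  classical
  have := finpartition_finite hV
  have hC : (connectedPartitions G).Finite := Set.toFinite _
  rw [finsum_mem_eq_finite_toFinset_sum _ hC, Z_eq_sum_powerset hV hE hq]
  simp_rw [← sum_filter_components_eq_prod hV hE b J, Finset.mul_sum, Finset.sum_filter]
  rw [Finset.sum_comm]
  refine Finset.sum_congr rfl fun A _ ↦ ?_
  have hparts := coe_parts_componentPartition hV (A : Set β)
  -- Each edge set `A` contributes to one partition only, that into its own components.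
  rw [Finset.sum_eq_single_of_mem (componentPartition hV (A : Set β))]
  · rw [if_pos hparts.symm, componentWeight, ← hparts, finprod_mem_coe_finset, mul_comm]
  · refine hC.mem_toFinset.2 fun B hB ↦ isConnected_induce_of_mem_components (A := A) ?_
    rw [← hparts]
    exact hB
  · intro π _ hne
    refine if_neg fun h ↦ hne (Finpartition.ext (Finset.coe_injective ?_))
    rw [hparts, h]

end Partitions

end Potts

theorem theoremt {α β : Type*} [LinearOrder β] (G : Graph α β)
    (hV : G.vertexSet.Finite) (hE : G.edgeSet.Finite)
    (q : ℕ) (hq : 1 ≤ q) (b : ℂ) (J : β → ℂ) (z : α → ℂ) :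
    -- expansion over connected partitions
    ((∀ B ⊆ G.vertexSet, ∃! P : Polynomial ℂ, Potts.IsZeroPolynomial (G.induce B) b J P) ∧
      Potts.Z G q b J z =
        ∑ᶠ π ∈ Potts.connectedPartitions G,
          (∏ B ∈ π.parts, Potts.X q b (Potts.weightSum z B)) *
            ∏ B ∈ π.parts, (Potts.zeroPolynomial (G.induce B) b J).coeff 1) ∧
    -- expansion over spanning forests
    (Potts.Z G q b J z =
        ∑ᶠ F ∈ Potts.spanningForests G,
          (∏ᶠ S ∈ Potts.components (G.restrict F), Potts.X q b (Potts.weightSum z S)) *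
            (∏ᶠ e ∈ F, (Complex.exp (b * J e) - 1)) *
              ∏ᶠ e ∈ Potts.externallyActive G F, Complex.exp (b * J e)) ∧
    -- expansion over spanning trees
    (Potts.Z G q b J z =
        ∑ᶠ T ∈ Potts.spanningTrees G,
          (∏ᶠ e ∈ Potts.internallyInactive G T, (Complex.exp (b * J e) - 1)) *
            (∏ᶠ e ∈ Potts.externallyActive G T, Complex.exp (b * J e)) *
              Potts.Z (Potts.contract (G.restrict T) (Potts.internallyInactive G T)) q b J
                (Potts.weightSum z)) := by
  refine ⟨⟨fun B hB ↦ ?_, Potts.Z_eq_finsum_connectedPartitions hV hE hq b J z⟩,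
    Potts.Z_eq_finsum_spanningForests hV hE hq b J z, Potts.Z_eq_finsum_spanningTrees hV hE hq b J z⟩
  have h := Potts.isZeroPolynomial_clusterPolynomial (H := G.induce B) (hV.subset hB)
    (hE.subset Potts.edgeSet_induce_subset) b J
  exact ⟨_, h, fun P hP ↦ hP.unique h⟩
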